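/- A multi-agent contract setting with $n$ agents consists of a monotone value function $f:2^{[n]}\to\mathbb{R}_{\ge 0}$ with $f(\emptyset)=0$ and of individual costs $c_1,\dots,c_n$ with $0<c_i\le f(\{i\})$ for every $i$. Write $f(i:S)=f(S\cup\{i\})-f(S\setminus\{i\})$ and $\rho(S)=\sum_{i\in S}c_i/f(i:S)$ (where $c_i/0=\infty$). For $b>0$, a set $S\subseteq[n]$ is $b$-feasible if $\rho(S)\le b$. The function $f$ is XOS if it is the pointwise maximum of finitely many non-negative additive set functions. A value oracle returns $f(S)$ on query $S$; for $a\in(0,1]$, an $a$-demand oracle returns, on a query $p\in\mathbb{R}_{\ge 0}^n$, a set $S$ such that $f(S)-\sum_{i\in S}p_i\ge a f(T)-\sum_{i\in T}p_i$ for every $T\subseteq[n]$; an exact demand oracle returns a set maximizing $f(S)-\sum_{i\in S}p_i$. Running time is the number of steps of a real random access machine whose unit-cost operations are real arithmetic with $+,-,\cdot,/,\sqrt{\ }$ and comparisons, together with addition, truncated subtraction and comparison of natural numbers used as indices; an oracle query costs $n+1$ steps. There is a single deterministic algorithm that, given $n$, $c$, $a\in(0,1]$ and a finite $b>0$, and given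 access to a value oracle and an $a$-demand oracle for an XOS function $f$ such that $(f,c)$ is a multi-agent contract setting with $n$ agents, runs in time polynomial in $n$ (the polynomial depends on nothing else) and outputs a $b$-feasible set $U$ whose value is a $\left(\frac{3}{A}+\varepsilon_a(n)\right)$-approximation of the optimal value subject to $b$-feasibility, where $A=(a/4)^2$: every $b$-feasible $T$ satisfies $f(T)\le\left(\frac{3}{A}+\varepsilon_a(n)\right)f(U)$. Here $\varepsilon_a(n)$ depends only on $a$ and $n$, and $\varepsilon_a(n)\to 0$ as $n\to\infty$ for every fixed $a\in(0,1]$. In particular, with an exact demand oracle (and $a=1$), the algorithm guarantees a $(48+\varepsilon_1(n))$-approximation. Moreover, for all $b,b'>0$ and every multi-agent contract setting $(f,c)$, a set is $b$-feasible in $(f,c)$ if and only if it is $b'$-feasible for the value function $f$ and the costs $\frac{b'}{b}c_i$. -/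

import Mathlib

open Filter Topology

namespace MultiAgentContract

/-! ## Multi-agent contract settings -/

/-- A multi-agent contract setting with `n` agents: a monotone normalized value function `f` and
strictly positive individual costs `c`, where every single agent has positive value, which upper
bounds its cost. -/
structure Setting (n : ℕ) where
  f : Finset (Fin n) → ℝ
  c : Fin n → ℝ
  mono : ∀ S T : Finset (Fin n), S ⊆ T → f S ≤ f T
  empty : f ∅ = 0
  cost_pos : ∀ i, 0 < c i
  single_pos : ∀ i, 0 < f {i}
  cost_le_single : ∀ i, c i ≤ f {i}

/-- `f` is XOS: the pointwise maximum of a finite nonempty family of nonnegative additive set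
functions. -/
def IsXOS {n : ℕ} (f : Finset (Fin n) → ℝ) : Prop :=
  ∃ (k : ℕ) (w : Fin (k + 1) → Fin n → ℝ), (∀ j i, 0 ≤ w j i) ∧
    ∀ S, IsGreatest (Set.range fun j => ∑ i ∈ S, w j i) (f S)

/-- The marginal `f (i : S) = f (S ∪ {i}) - f (S \ {i})`. -/
def marginal {n : ℕ} (f : Finset (Fin n) → ℝ) (i : Fin n) (S : Finset (Fin n)) : ℝ :=
  f (insert i S) - f (S.erase i)

/-- The minimum total share `ρ(S) = ∑ i ∈ S, c i / f (i : S)` needed to incentivize `S`. It is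
extended-nonnegative valued: an agent of positive cost with zero marginal needs an infinite share. -/
noncomputable def totalShare {n : ℕ} (f : Finset (Fin n) → ℝ) (c : Fin n → ℝ)
    (S : Finset (Fin n)) : ENNReal :=
  ∑ i ∈ S, ENNReal.ofReal (c i) / ENNReal.ofReal (marginal f i S)

/-- `S` is `b`-feasible: `ρ(S) ≤ b`. -/
def IsFeasible {n : ℕ} (f : Finset (Fin n) → ℝ) (c : Fin n → ℝ) (b : ℝ)
    (S : Finset (Fin n)) : Prop :=
  totalShare f c S ≤ ENNReal.ofReal b

/-- `U` is `b`-feasible and its value is an `r`-approximation of the optimal value subject to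
`b`-feasibility, that is, `f T ≤ r * f U` for every `b`-feasible set `T`. -/
def IsValueApprox {n : ℕ} (f : Finset (Fin n) → ℝ) (c : Fin n → ℝ) (b r : ℝ)
    (U : Finset (Fin n)) : Prop :=
  IsFeasible f c b U ∧ ∀ T, IsFeasible f c b T → f T ≤ r * f U

/-- `S` is a demand set for the prices `p`: it maximizes `f S - p(S)`. -/
def IsDemandSet {n : ℕ} (f : Finset (Fin n) → ℝ) (p : Fin n → ℝ) (S : Finset (Fin n)) : Prop :=
  ∀ T : Finset (Fin n), f T - ∑ i ∈ T, p i ≤ f S - ∑ i ∈ S, p i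

/-- `S` is an `a`-demand set for the prices `p`: `f S - p(S) ≥ a * f T - p(T)` for all `T`. -/
def IsApproxDemandSet {n : ℕ} (a : ℝ) (f : Finset (Fin n) → ℝ) (p : Fin n → ℝ)
    (S : Finset (Fin n)) : Prop :=
  ∀ T : Finset (Fin n), a * f T - ∑ i ∈ T, p i ≤ f S - ∑ i ∈ S, p i

/-- `D` answers every nonnegative price vector by a demand set; nothing is promised about other
queries. -/
def IsDemandOracle {n : ℕ} (f : Finset (Fin n) → ℝ)
    (D : (Fin n → ℝ) → Finset (Fin n)) : Prop :=
  ∀ p : Fin n → ℝ, (∀ i, 0 ≤ p i) → IsDemandSet f p (D p)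

/-- `D` answers every nonnegative price vector by an `a`-demand set; nothing is promised about
other queries. -/
def IsApproxDemandOracle {n : ℕ} (a : ℝ) (f : Finset (Fin n) → ℝ)
    (D : (Fin n → ℝ) → Finset (Fin n)) : Prop :=
  ∀ p : Fin n → ℝ, (∀ i, 0 ≤ p i) → IsApproxDemandSet a f p (D p)

/-! ## Algorithms: a real random access machine with oracles

A program is a finite piece of syntax, independent of the number of agents and of the instance. It
works on natural-number registers and arrays (addition and truncated subtraction), real registers
and arrays (field operations, square root, comparisons; there is no conversion from reals to
natural numbers), and Boolean arrays, which hold sets of agents. The only constants are natural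
numbers. Every operation costs one step; an oracle query costs `n + 1` steps. -/

/-- Memory of the machine; registers and arrays are named by natural numbers. -/
structure Store where
  natReg : ℕ → ℕ
  natArr : ℕ → ℕ → ℕ
  realReg : ℕ → ℝ
  realArr : ℕ → ℕ → ℝ
  boolArr : ℕ → ℕ → Bool

inductive NatExp where
  | const (k : ℕ)
  | reg (x : ℕ)
  | arr (x : ℕ) (index : NatExp)
  | add (e₁ e₂ : NatExp)
  | sub (e₁ e₂ : NatExp)

inductive RealExp where
  | ofNat (e : NatExp)
  | reg (x : ℕ)
  | arr (x : ℕ) (index : NatExp)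
  | add (e₁ e₂ : RealExp)
  | sub (e₁ e₂ : RealExp)
  | mul (e₁ e₂ : RealExp)
  | div (e₁ e₂ : RealExp)
  | sqrt (e : RealExp)

inductive BoolExp where
  | const (v : Bool)
  | arr (x : ℕ) (index : NatExp)
  | natLt (e₁ e₂ : NatExp)
  | realLt (e₁ e₂ : RealExp)
  | not (e : BoolExp)
  | and (e₁ e₂ : BoolExp)

def NatExp.eval (σ : Store) : NatExp → ℕ
  | const k => k
  | reg x => σ.natReg x
  | arr x e => σ.natArr x (e.eval σ)
  | add e₁ e₂ => e₁.eval σ + e₂.eval σ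
  | sub e₁ e₂ => e₁.eval σ - e₂.eval σ

/-- Division by zero and square roots of negative numbers return `0`. -/
noncomputable def RealExp.eval (σ : Store) : RealExp → ℝ
  | ofNat e => (e.eval σ : ℝ)
  | reg x => σ.realReg x
  | arr x e => σ.realArr x (e.eval σ)
  | add e₁ e₂ => e₁.eval σ + e₂.eval σ
  | sub e₁ e₂ => e₁.eval σ - e₂.eval σ
  | mul e₁ e₂ => e₁.eval σ * e₂.eval σ
  | div e₁ e₂ => e₁.eval σ / e₂.eval σ
  | sqrt e => Real.sqrt (e.eval σ)

open Classical in
noncomputable def BoolExp.eval (σ : Store) : BoolExp → Bool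
  | const v => v
  | arr x e => σ.boolArr x (e.eval σ)
  | natLt e₁ e₂ => decide (e₁.eval σ < e₂.eval σ)
  | realLt e₁ e₂ => decide (e₁.eval σ < e₂.eval σ)
  | not e => !(e.eval σ)
  | and e₁ e₂ => e₁.eval σ && e₂.eval σ

/-- Cost of evaluating an expression: its number of nodes. -/
def NatExp.cost : NatExp → ℕ
  | const _ => 1
  | reg _ => 1
  | arr _ e => e.cost + 1
  | add e₁ e₂ => e₁.cost + e₂.cost + 1
  | sub e₁ e₂ => e₁.cost + e₂.cost + 1

def RealExp.cost : RealExp → ℕ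
  | ofNat e => e.cost + 1
  | reg _ => 1
  | arr _ e => e.cost + 1
  | add e₁ e₂ => e₁.cost + e₂.cost + 1
  | sub e₁ e₂ => e₁.cost + e₂.cost + 1
  | mul e₁ e₂ => e₁.cost + e₂.cost + 1
  | div e₁ e₂ => e₁.cost + e₂.cost + 1
  | sqrt e => e.cost + 1

def BoolExp.cost : BoolExp → ℕ
  | const _ => 1
  | arr _ e => e.cost + 1
  | natLt e₁ e₂ => e₁.cost + e₂.cost + 1
  | realLt e₁ e₂ => e₁.cost + e₂.cost + 1
  | not e => e.cost + 1
  | and e₁ e₂ => e₁.cost + e₂.cost + 1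

/-- Programs. `valueQuery x s` stores in real register `x` the value of the set held in Boolean
array `s`; `demandQuery s p` stores in Boolean array `s` the answer of the demand oracle to the
price vector held in real array `p`. -/
inductive Program where
  | skip
  | setNat (x : ℕ) (e : NatExp)
  | setNatArr (x : ℕ) (index : NatExp) (e : NatExp)
  | setReal (x : ℕ) (e : RealExp)
  | setRealArr (x : ℕ) (index : NatExp) (e : RealExp)
  | setBoolArr (x : ℕ) (index : NatExp) (e : BoolExp)
  | valueQuery (x : ℕ) (s : ℕ)
  | demandQuery (s : ℕ) (p : ℕ)
  | seq (P Q : Program)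
  | ite (e : BoolExp) (P Q : Program)
  | while (e : BoolExp) (P : Program)

/-- The set of agents held in Boolean array `x`. -/
def Store.team (n : ℕ) (σ : Store) (x : ℕ) : Finset (Fin n) :=
  Finset.univ.filter fun i => σ.boolArr x i = true

/-- A set of agents as the contents of a Boolean array. -/
def encodeTeam {n : ℕ} (S : Finset (Fin n)) (j : ℕ) : Bool :=
  if h : j < n then decide (⟨j, h⟩ ∈ S) else false

/-- `Exec f D P σ t σ'`: with value oracle `f` and demand oracle `D`, the program `P` started in
memory `σ` halts after exactly `t` steps in memory `σ'`. -/
inductive Exec {n : ℕ} (f : Finset (Fin n) → ℝ) (D : (Fin n → ℝ) → Finset (Fin n)) :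
    Program → Store → ℕ → Store → Prop where
  | skip (σ : Store) : Exec f D .skip σ 1 σ
  | setNat (σ : Store) (x : ℕ) (e : NatExp) :
      Exec f D (.setNat x e) σ (e.cost + 1)
        { σ with natReg := Function.update σ.natReg x (e.eval σ) }
  | setNatArr (σ : Store) (x : ℕ) (i e : NatExp) :
      Exec f D (.setNatArr x i e) σ (i.cost + e.cost + 1)
        { σ with
          natArr := Function.update σ.natArr x
            (Function.update (σ.natArr x) (i.eval σ) (e.eval σ)) }
  | setReal (σ : Store) (x : ℕ) (e : RealExp) :
      Exec f D (.setReal x e) σ (e.cost + 1)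
        { σ with realReg := Function.update σ.realReg x (e.eval σ) }
  | setRealArr (σ : Store) (x : ℕ) (i : NatExp) (e : RealExp) :
      Exec f D (.setRealArr x i e) σ (i.cost + e.cost + 1)
        { σ with
          realArr := Function.update σ.realArr x
            (Function.update (σ.realArr x) (i.eval σ) (e.eval σ)) }
  | setBoolArr (σ : Store) (x : ℕ) (i : NatExp) (e : BoolExp) :
      Exec f D (.setBoolArr x i e) σ (i.cost + e.cost + 1)
        { σ with
          boolArr := Function.update σ.boolArr x
            (Function.update (σ.boolArr x) (i.eval σ) (e.eval σ)) }
  | valueQuery (σ : Store) (x s : ℕ) :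
      Exec f D (.valueQuery x s) σ (n + 1)
        { σ with realReg := Function.update σ.realReg x (f (σ.team n s)) }
  | demandQuery (σ : Store) (s p : ℕ) :
      Exec f D (.demandQuery s p) σ (n + 1)
        { σ with
          boolArr := Function.update σ.boolArr s
            (encodeTeam (D fun i => σ.realArr p i)) }
  | seq {P Q : Program} {σ σ' σ'' : Store} {t t' : ℕ} :
      Exec f D P σ t σ' → Exec f D Q σ' t' σ'' → Exec f D (.seq P Q) σ (t + t') σ''
  | iteTrue {e : BoolExp} {P Q : Program} {σ σ' : Store} {t : ℕ} :
      e.eval σ = true → Exec f D P σ t σ' → Exec f D (.ite e P Q) σ (e.cost + t + 1) σ'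
  | iteFalse {e : BoolExp} {P Q : Program} {σ σ' : Store} {t : ℕ} :
      e.eval σ = false → Exec f D Q σ t σ' → Exec f D (.ite e P Q) σ (e.cost + t + 1) σ'
  | whileTrue {e : BoolExp} {P : Program} {σ σ' σ'' : Store} {t t' : ℕ} :
      e.eval σ = true → Exec f D P σ t σ' → Exec f D (.while e P) σ' t' σ'' →
        Exec f D (.while e P) σ (e.cost + t + t' + 1) σ''
  | whileFalse {e : BoolExp} {P : Program} {σ : Store} :
      e.eval σ = false → Exec f D (.while e P) σ (e.cost + 1) σ

/-- Initial memory: natural register `0` holds `n`, real registers `0` and `1` hold the oracle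
quality `a` and the budget `b`, real array `0` holds the costs, everything else is blank. -/
noncomputable def initialStore {n : ℕ} (c : Fin n → ℝ) (a b : ℝ) : Store where
  natReg := fun x => if x = 0 then n else 0
  natArr := fun _ _ => 0
  realReg := fun x => if x = 0 then a else if x = 1 then b else 0
  realArr := fun x j => if x = 0 then (if h : j < n then c ⟨j, h⟩ else 0) else 0
  boolArr := fun _ _ => false

/-- With value oracle `f` and demand oracle `D`, on input `(n, c, a, b)` the program halts within
`t` steps and its output, the set held in Boolean array `0`, is `U`. -/
def Outputs {n : ℕ} (f : Finset (Fin n) → ℝ) (D : (Fin n → ℝ) → Finset (Fin n))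
    (c : Fin n → ℝ) (a b : ℝ) (P : Program) (t : ℕ) (U : Finset (Fin n)) : Prop :=
  ∃ (s : ℕ) (σ : Store), Exec f D P (initialStore c a b) s σ ∧ s ≤ t ∧ σ.team n 0 = U

end MultiAgentContract

namespace MultiAgentContract

/-! ## Value functions -/

section Value

variable {n : ℕ} {f : Finset (Fin n) → ℝ}

/-! Fix a target `x`, put `u = (a/4)^2 * x`, and offer agent `i` at the price `p i = (a/2) * √(c i *
x / b)`. For feasible `T`, Cauchy–Schwarz and the XOS inequality `∑ marginal ≤ f` give `(∑ √(c i))^2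
≤ b * f T`, so `p(T) ≤ (a/2) * f T` whenever `x ≤ f T` (`IsFeasible.sum_price_le`). An `a`-demand
set then has utility at least `a * x / 2`. Conversely, a set of value at most `u` whose marginals
are at least half the prices is feasible, because `c i / marginal ≤ (b / u) * marginal`
(`isFeasible_of_price_le`).

To get from the demand set to such a set, agents whose marginal is below their price are dropped,
which only raises utility. Then agents are deleted until the value is at most `u`; if every agent
left is worth at most `u/3` alone, the value stays at least `2u/3`. The earlier marginals dominate
the prices, so the remaining set `S₂` has `p(S₂) ≤ f S₂`, and pruning at half prices keeps at least
half the value, that is `u/3` (`third_le_of_demand`). If some feasible agent is worth more than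
`u/3`, it is itself good enough; infeasible agents get a prohibitive price.

With `M` the best feasible single value, every feasible value is at most `n * M`. The targets start
at `M` and grow by the factor `1 + 1/n`; this grid costs the `ε` term, and `n^2` rounds suffice. The
rest is a time-bounded program logic with frame conditions, by which the program is verified. -/

theorem marginal_of_mem {S : Finset (Fin n)} {i : Fin n} (hi : i ∈ S) :
    marginal f i S = f S - f (S.erase i) := by
  rw [marginal, Finset.insert_eq_of_mem hi]

/-- The additive function attaining the maximum at `S` supports `f` at `S`. -/
theorem IsXOS.exists_support (hf : IsXOS f) (S : Finset (Fin n)) :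
    ∃ w : Fin n → ℝ, (∀ i, 0 ≤ w i) ∧ f S = ∑ i ∈ S, w i ∧ ∀ R, ∑ i ∈ R, w i ≤ f R := by
  obtain ⟨k, w, hw, h⟩ := hf
  obtain ⟨j, hj⟩ := (h S).1
  exact ⟨w j, hw j, hj.symm, fun R => (h R).2 ⟨j, rfl⟩⟩

/-- If `w` supports `f` at `S`, then `f (S.erase i) ≥ w(S) - w i`, so the marginal of `i` is at most
`w i`, and `w(R) ≤ f R`. Allowing `R ≠ S` matters: after deletions, the marginals in the larger set
still pay for the smaller one. -/
theorem IsXOS.sum_marginal_le (hf : IsXOS f) {R S : Finset (Fin n)} (hRS : R ⊆ S) :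
    ∑ i ∈ R, marginal f i S ≤ f R := by
  obtain ⟨w, -, hS, hw⟩ := hf.exists_support S
  refine (Finset.sum_le_sum fun i hi => ?_).trans (hw R)
  rw [marginal_of_mem (hRS hi), hS, ← Finset.add_sum_erase _ _ (hRS hi)]
  linarith [hw (S.erase i)]

theorem IsXOS.marginal_le_single (hf : IsXOS f) {S : Finset (Fin n)} {i : Fin n} (hi : i ∈ S) :
    marginal f i S ≤ f {i} := by
  simpa using hf.sum_marginal_le (Finset.singleton_subset_iff.2 hi)

theorem IsXOS.le_sum_single (hf : IsXOS f) (S : Finset (Fin n)) : f S ≤ ∑ i ∈ S, f {i} := by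
  obtain ⟨w, -, hS, hw⟩ := hf.exists_support S
  rw [hS]
  exact Finset.sum_le_sum fun i _ => by simpa using hw {i}

/-- The share of an agent as a real number, with a value exceeding the budget in place of `∞`. -/
noncomputable def realShare (f : Finset (Fin n) → ℝ) (c : Fin n → ℝ) (b : ℝ)
    (S : Finset (Fin n)) (i : Fin n) : ℝ :=
  if 0 < marginal f i S then c i / marginal f i S else b + 1

variable {c : Fin n → ℝ} {b : ℝ}

theorem realShare_nonneg (hc : ∀ i, 0 < c i) (hb : 0 < b) (S : Finset (Fin n)) (i : Fin n) :
    0 ≤ realShare f c b S i := by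
  unfold realShare
  split_ifs with h
  · exact (div_pos (hc i) h).le
  · linarith

/-- Turns feasibility into a real inequality that the machine can test: one agent of nonpositive
marginal breaks the budget on both sides, through `∞` on the left and `b + 1` on the right. -/
theorem isFeasible_iff (hc : ∀ i, 0 < c i) (hb : 0 < b) {S : Finset (Fin n)} :
    IsFeasible f c b S ↔ ∑ i ∈ S, realShare f c b S i ≤ b := by
  by_cases h : ∀ i ∈ S, 0 < marginal f i S
  · rw [IsFeasible, totalShare, ← ENNReal.ofReal_le_ofReal_iff hb.le,
      ENNReal.ofReal_sum_of_nonneg fun i _ => realShare_nonneg hc hb S i]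
    rw [Finset.sum_congr rfl fun i hi => ?_]
    rw [realShare, if_pos (h i hi), ENNReal.ofReal_div_of_pos (h i hi)]
  · push Not at h
    obtain ⟨i, hi, hm⟩ := h
    refine iff_of_false (fun hS => ?_) fun hS => ?_
    · have h1 := (Finset.single_le_sum (f := fun i =>
        ENNReal.ofReal (c i) / ENNReal.ofReal (marginal f i S)) (fun _ _ => zero_le) hi).trans hS
      rw [ENNReal.ofReal_of_nonpos hm, ENNReal.div_zero (by simpa using hc i)] at h1
      exact ENNReal.ofReal_ne_top (top_le_iff.1 h1)
    · have h1 := (Finset.single_le_sum (fun j _ => realShare_nonneg hc hb S j) hi).trans hS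
      rw [realShare, if_neg hm.not_gt] at h1
      linarith

theorem IsFeasible.marginal_pos (hc : ∀ i, 0 < c i) (hb : 0 < b) {S : Finset (Fin n)}
    (hS : IsFeasible f c b S) {i : Fin n} (hi : i ∈ S) : 0 < marginal f i S := by
  by_contra hm
  have h1 := (Finset.single_le_sum (fun j _ => realShare_nonneg hc hb S j) hi).trans
    ((isFeasible_iff hc hb).1 hS)
  rw [realShare, if_neg hm] at h1
  linarith

theorem IsFeasible.sum_div_le (hc : ∀ i, 0 < c i) (hb : 0 < b) {S : Finset (Fin n)}
    (hS : IsFeasible f c b S) : ∑ i ∈ S, c i / marginal f i S ≤ b := by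
  refine le_of_eq_of_le (Finset.sum_congr rfl fun i hi => ?_) ((isFeasible_iff hc hb).1 hS)
  rw [realShare, if_pos (hS.marginal_pos hc hb hi)]

theorem isFeasible_of_sum_div_le (hc : ∀ i, 0 < c i) (hb : 0 < b) {S : Finset (Fin n)}
    (hm : ∀ i ∈ S, 0 < marginal f i S) (h : ∑ i ∈ S, c i / marginal f i S ≤ b) :
    IsFeasible f c b S := by
  refine (isFeasible_iff hc hb).2 (le_of_eq_of_le (Finset.sum_congr rfl fun i hi => ?_) h)
  rw [realShare, if_pos (hm i hi)]

theorem isFeasible_empty (hc : ∀ i, 0 < c i) (hb : 0 < b) : IsFeasible f c b ∅ :=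
  isFeasible_of_sum_div_le hc hb (by simp) (by simpa using hb.le)

theorem isFeasible_singleton (h0 : f ∅ = 0) (hc : ∀ i, 0 < c i) (hb : 0 < b) {i : Fin n}
    (h : c i ≤ b * f {i}) : IsFeasible f c b {i} := by
  have hp : 0 < f {i} := pos_of_mul_pos_right ((hc i).trans_le h) hb.le
  have hm : marginal f i {i} = f {i} := by simp [marginal, h0]
  refine isFeasible_of_sum_div_le hc hb (by simpa [hm] using hp) ?_
  simpa [hm] using (div_le_iff₀ hp).2 h

/-- An agent of a feasible set is feasible on its own. -/
theorem IsFeasible.cost_le (hf : IsXOS f) (hc : ∀ i, 0 < c i) (hb : 0 < b) {S : Finset (Fin n)}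
    (hS : IsFeasible f c b S) {i : Fin n} (hi : i ∈ S) : c i ≤ b * f {i} := by
  have hm := hS.marginal_pos hc hb hi
  have h1 : c i / marginal f i S ≤ b :=
    (Finset.single_le_sum (f := fun j => c j / marginal f j S)
      (fun j hj => (div_pos (hc j) (hS.marginal_pos hc hb hj)).le) hi).trans
      (hS.sum_div_le hc hb)
  exact ((div_le_iff₀ hm).1 h1).trans (mul_le_mul_of_nonneg_left (hf.marginal_le_single hi) hb.le)

/-- Cauchy–Schwarz for the factors `c i / marginal` and `marginal`, whose product is `c i`; the
first sums to at most `b`, the second to at most `f S`. -/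
theorem IsFeasible.sum_sqrt_sq_le (hf : IsXOS f) (hc : ∀ i, 0 < c i) (hb : 0 < b)
    {S : Finset (Fin n)} (hS : IsFeasible f c b S) : (∑ i ∈ S, √(c i)) ^ 2 ≤ b * f S := by
  have hm := fun i hi => hS.marginal_pos hc hb (i := i) hi
  refine (Finset.sum_sq_le_sum_mul_sum_of_sq_le_mul S (f := fun i => c i / marginal f i S)
    (g := fun i => marginal f i S) (fun i hi => (div_pos (hc i) (hm i hi)).le)
    (fun i hi => (hm i hi).le) fun i hi => ?_).trans ?_
  · rw [Real.sq_sqrt (hc i).le, div_mul_cancel₀ _ (hm i hi).ne']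
  · exact mul_le_mul (hS.sum_div_le hc hb) (hf.sum_marginal_le subset_rfl)
      (Finset.sum_nonneg fun i hi => (hm i hi).le) hb.le

/-- The price at which an agent is offered when the target value is `x`. -/
noncomputable def price (c : Fin n → ℝ) (a b x : ℝ) (i : Fin n) : ℝ := a / 2 * √(c i * x / b)

theorem IsFeasible.sum_price_le (hf : IsXOS f) (hc : ∀ i, 0 < c i) (hb : 0 < b)
    {S : Finset (Fin n)} (hS : IsFeasible f c b S) {a x : ℝ} (ha : 0 < a) (hx : 0 < x)
    (hxS : x ≤ f S) : ∑ i ∈ S, price c a b x i ≤ a / 2 * f S := by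
  have h1 := hS.sum_sqrt_sq_le hf hc hb
  unfold price
  rw [← Finset.mul_sum]
  refine mul_le_mul_of_nonneg_left ?_ (by positivity)
  have h2 : ∀ i, √(c i * x / b) = √(c i) * √(x / b) := fun i => by
    rw [← Real.sqrt_mul (hc i).le, mul_div_assoc]
  simp_rw [h2]
  rw [← Finset.sum_mul]
  refine abs_le_of_sq_le_sq' ?_ (hx.le.trans hxS) |>.2
  rw [mul_pow, Real.sq_sqrt (by positivity)]
  calc _ ≤ b * f S * (x / b) := by gcongr
    _ = f S * x := by field_simp
    _ ≤ f S ^ 2 := by nlinarith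

/-- Marginals of at least half the prices make a set of moderate value feasible. -/
theorem isFeasible_of_price_le (hf : IsXOS f) (hc : ∀ i, 0 < c i) (hb : 0 < b)
    {S : Finset (Fin n)} {a x : ℝ} (ha : 0 < a) (hx : 0 < x)
    (hm : ∀ i ∈ S, price c a b x i / 2 ≤ marginal f i S) (hS : f S ≤ (a / 4) ^ 2 * x) :
    IsFeasible f c b S := by
  have hp : ∀ i, 0 < price c a b x i := fun i => by
    have := hc i
    unfold price; positivity
  have hm' : ∀ i ∈ S, 0 < marginal f i S := fun i hi => (half_pos (hp i)).trans_le (hm i hi)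
  refine isFeasible_of_sum_div_le hc hb hm' ?_
  calc ∑ i ∈ S, c i / marginal f i S
      ≤ ∑ i ∈ S, b / ((a / 4) ^ 2 * x) * marginal f i S := by
        refine Finset.sum_le_sum fun i hi => ?_
        have h0 := hc i
        have h1 : (price c a b x i / 2) ^ 2 ≤ marginal f i S ^ 2 :=
          pow_le_pow_left₀ (half_pos (hp i)).le (hm i hi) 2
        rw [price, div_pow, mul_pow, Real.sq_sqrt (by positivity)] at h1
        rw [div_le_iff₀ (hm' i hi)]
        -- The square of half the price is `(a/4)^2 * c i * x / b`; this is where the constant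
        -- `(a/4)^2` comes from.
        calc c i = b / ((a / 4) ^ 2 * x) * ((a / 2) ^ 2 * (c i * x / b) / 2 ^ 2) := by
              field_simp; norm_num
          _ ≤ b / ((a / 4) ^ 2 * x) * marginal f i S ^ 2 := by gcongr
          _ = _ := by ring
    _ = b / ((a / 4) ^ 2 * x) * ∑ i ∈ S, marginal f i S := by rw [Finset.mul_sum]
    _ ≤ b / ((a / 4) ^ 2 * x) * ((a / 4) ^ 2 * x) := by
        gcongr
        exact (hf.sum_marginal_le subset_rfl).trans hS
    _ = b := by field_simp

/-- Scaling the costs and the budget by the same factor preserves feasibility. -/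
theorem isFeasible_scale (hc : ∀ i, 0 < c i) (hb : 0 < b) {b' : ℝ} (hb' : 0 < b')
    (S : Finset (Fin n)) :
    IsFeasible f c b S ↔ IsFeasible f (fun i => b' / b * c i) b' S := by
  -- One direction suffices: the converse is the same implication with the budgets exchanged, since
  -- the two scalings cancel.
  have key : ∀ {b b' : ℝ} {c : Fin n → ℝ}, (∀ i, 0 < c i) → 0 < b → 0 < b' →
      IsFeasible f c b S → IsFeasible f (fun i => b' / b * c i) b' S := by
    intro b b' c hc hb hb' h
    refine isFeasible_of_sum_div_le (fun i => mul_pos (div_pos hb' hb) (hc i)) hb'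
      (fun i hi => h.marginal_pos hc hb hi) ?_
    simp_rw [mul_div_assoc]
    rw [← Finset.mul_sum]
    calc _ ≤ b' / b * b := by
          gcongr
          exact h.sum_div_le hc hb
      _ = b' := by field_simp
  refine ⟨key hc hb hb', fun h => ?_⟩
  have := key (fun i => mul_pos (div_pos hb' hb) (hc i)) hb' hb h
  convert this using 2 with i
  field_simp

end Value

/-! ## Reasoning about programs -/

namespace Program

/-- The registers or arrays of each sort that a program may write. -/
def natWrites : Program → List ℕ
  | setNat x _ => [x]
  | seq P Q => P.natWrites ++ Q.natWrites
  | ite _ P Q => P.natWrites ++ Q.natWrites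
  | .while _ P => P.natWrites
  | _ => []

def realWrites : Program → List ℕ
  | setReal x _ => [x]
  | valueQuery x _ => [x]
  | seq P Q => P.realWrites ++ Q.realWrites
  | ite _ P Q => P.realWrites ++ Q.realWrites
  | .while _ P => P.realWrites
  | _ => []

def realArrWrites : Program → List ℕ
  | setRealArr x _ _ => [x]
  | seq P Q => P.realArrWrites ++ Q.realArrWrites
  | ite _ P Q => P.realArrWrites ++ Q.realArrWrites
  | .while _ P => P.realArrWrites
  | _ => []

def boolArrWrites : Program → List ℕ
  | setBoolArr x _ _ => [x]
  | demandQuery x _ => [x]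
  | seq P Q => P.boolArrWrites ++ Q.boolArrWrites
  | ite _ P Q => P.boolArrWrites ++ Q.boolArrWrites
  | .while _ P => P.boolArrWrites
  | _ => []

end Program

/-- The memories agree on everything that `P` does not write. -/
structure Frame (P : Program) (σ σ' : Store) : Prop where
  nat : ∀ x, x ∉ P.natWrites → σ'.natReg x = σ.natReg x
  real : ∀ x, x ∉ P.realWrites → σ'.realReg x = σ.realReg x
  realArr : ∀ x, x ∉ P.realArrWrites → σ'.realArr x = σ.realArr x
  boolArr : ∀ x, x ∉ P.boolArrWrites → σ'.boolArr x = σ.boolArr x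

theorem Frame.refl (P : Program) (σ : Store) : Frame P σ σ :=
  ⟨fun _ _ => rfl, fun _ _ => rfl, fun _ _ => rfl, fun _ _ => rfl⟩

theorem Frame.trans {P : Program} {σ σ' σ'' : Store} (h : Frame P σ σ') (h' : Frame P σ' σ'') :
    Frame P σ σ'' :=
  ⟨fun x hx => (h'.nat x hx).trans (h.nat x hx), fun x hx => (h'.real x hx).trans (h.real x hx),
    fun x hx => (h'.realArr x hx).trans (h.realArr x hx),
    fun x hx => (h'.boolArr x hx).trans (h.boolArr x hx)⟩

theorem Frame.mono {P Q : Program} {σ σ' : Store} (h : Frame P σ σ')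
    (h₁ : P.natWrites ⊆ Q.natWrites) (h₂ : P.realWrites ⊆ Q.realWrites)
    (h₃ : P.realArrWrites ⊆ Q.realArrWrites) (h₄ : P.boolArrWrites ⊆ Q.boolArrWrites) :
    Frame Q σ σ' :=
  ⟨fun x hx => h.nat x fun h => hx (h₁ h), fun x hx => h.real x fun h => hx (h₂ h),
    fun x hx => h.realArr x fun h => hx (h₃ h), fun x hx => h.boolArr x fun h => hx (h₄ h)⟩

/-! ### Frame conditions and a time-bounded program logic -/

section Exec

variable {n : ℕ} {f : Finset (Fin n) → ℝ} {D : (Fin n → ℝ) → Finset (Fin n)}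

/-- The write lists of a concrete program are explicit lists of numerals, so most preservation
claims below reduce to `decide`. Natural-number arrays are not tracked, as the algorithm does not
use them. -/
theorem Exec.frame {P : Program} {σ σ' : Store} {t : ℕ} (h : Exec f D P σ t σ') :
    Frame P σ σ' := by
  induction h with
  | skip => exact Frame.refl _ _
  | seq _ _ h h' =>
    exact (h.mono (by simp [Program.natWrites]) (by simp [Program.realWrites])
      (by simp [Program.realArrWrites]) (by simp [Program.boolArrWrites])).trans
      (h'.mono (by simp [Program.natWrites]) (by simp [Program.realWrites])
      (by simp [Program.realArrWrites]) (by simp [Program.boolArrWrites]))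
  | iteTrue _ _ h =>
    exact h.mono (by simp [Program.natWrites]) (by simp [Program.realWrites])
      (by simp [Program.realArrWrites]) (by simp [Program.boolArrWrites])
  | iteFalse _ _ h =>
    exact h.mono (by simp [Program.natWrites]) (by simp [Program.realWrites])
      (by simp [Program.realArrWrites]) (by simp [Program.boolArrWrites])
  | whileTrue _ _ _ h h' =>
    exact Frame.trans ⟨h.nat, h.real, h.realArr, h.boolArr⟩ h'
  | whileFalse => exact Frame.refl _ _
  | _ =>
    constructor <;> intro x hx <;>
      simp_all [Program.natWrites, Program.realWrites, Program.realArrWrites,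
        Program.boolArrWrites, Function.update_of_ne]

/-- Started in `σ`, the program `P` halts within `t` steps in a memory satisfying `Q`. -/
def Runs (f : Finset (Fin n) → ℝ) (D : (Fin n → ℝ) → Finset (Fin n)) (P : Program) (σ : Store)
    (t : ℕ) (Q : Store → Prop) : Prop :=
  ∃ (s : ℕ) (σ' : Store), Exec f D P σ s σ' ∧ s ≤ t ∧ Q σ'

namespace Runs

variable {P P' : Program} {σ : Store} {t t' : ℕ} {Q Q' : Store → Prop}

theorem imp (h : Runs f D P σ t Q) (ht : t ≤ t') (hQ : ∀ σ', Frame P σ σ' → Q σ' → Q' σ') :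
    Runs f D P σ t' Q' :=
  let ⟨s, σ', h₁, h₂, h₃⟩ := h
  ⟨s, σ', h₁, h₂.trans ht, hQ _ h₁.frame h₃⟩

theorem le (h : Runs f D P σ t Q) (ht : t ≤ t') : Runs f D P σ t' Q := h.imp ht fun _ _ h => h

theorem skip (h : Q σ) : Runs f D .skip σ 1 Q := ⟨_, _, .skip σ, le_rfl, h⟩

theorem setNat {x : ℕ} {e : NatExp}
    (h : Q { σ with natReg := Function.update σ.natReg x (e.eval σ) }) :
    Runs f D (.setNat x e) σ (e.cost + 1) Q := ⟨_, _, .setNat σ x e, le_rfl, h⟩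

theorem setReal {x : ℕ} {e : RealExp}
    (h : Q { σ with realReg := Function.update σ.realReg x (e.eval σ) }) :
    Runs f D (.setReal x e) σ (e.cost + 1) Q := ⟨_, _, .setReal σ x e, le_rfl, h⟩

theorem setRealArr {x : ℕ} {i : NatExp} {e : RealExp}
    (h : Q { σ with
      realArr := Function.update σ.realArr x
        (Function.update (σ.realArr x) (i.eval σ) (e.eval σ)) }) :
    Runs f D (.setRealArr x i e) σ (i.cost + e.cost + 1) Q :=
  ⟨_, _, .setRealArr σ x i e, le_rfl, h⟩

theorem setBoolArr {x : ℕ} {i : NatExp} {e : BoolExp}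
    (h : Q { σ with
      boolArr := Function.update σ.boolArr x
        (Function.update (σ.boolArr x) (i.eval σ) (e.eval σ)) }) :
    Runs f D (.setBoolArr x i e) σ (i.cost + e.cost + 1) Q :=
  ⟨_, _, .setBoolArr σ x i e, le_rfl, h⟩

theorem valueQuery {x s : ℕ}
    (h : Q { σ with realReg := Function.update σ.realReg x (f (σ.team n s)) }) :
    Runs f D (.valueQuery x s) σ (n + 1) Q := ⟨_, _, .valueQuery σ x s, le_rfl, h⟩

theorem demandQuery {s p : ℕ}
    (h : Q { σ with
      boolArr := Function.update σ.boolArr s (encodeTeam (D fun i => σ.realArr p i)) }) :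
    Runs f D (.demandQuery s p) σ (n + 1) Q := ⟨_, _, .demandQuery σ s p, le_rfl, h⟩

theorem seq (h : Runs f D P σ t fun σ' => Runs f D P' σ' t' Q) :
    Runs f D (.seq P P') σ (t + t') Q :=
  let ⟨_, _, h₁, h₂, _, σ'', h₃, h₄, h₅⟩ := h
  ⟨_, σ'', h₁.seq h₃, Nat.add_le_add h₂ h₄, h₅⟩

theorem ite {e : BoolExp} (h : e.eval σ = true → Runs f D P σ t Q)
    (h' : e.eval σ = false → Runs f D P' σ t' Q) :
    Runs f D (.ite e P P') σ (e.cost + (t + t') + 1) Q := by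
  cases he : e.eval σ with
  | true =>
    obtain ⟨s, σ', h₁, h₂, h₃⟩ := h he
    exact ⟨_, σ', .iteTrue he h₁, by omega, h₃⟩
  | false =>
    obtain ⟨s, σ', h₁, h₂, h₃⟩ := h' he
    exact ⟨_, σ', .iteFalse he h₁, by omega, h₃⟩

/-- A loop with invariant `I`, indexed by the number of rounds, that makes at most `N` rounds. -/
theorem while_of_invariant {e : BoolExp} (I : ℕ → Store → Prop) (N t : ℕ) (h₀ : I 0 σ)
    (h : ∀ j σ', Frame P σ σ' → I j σ' → e.eval σ' = true →
      j < N ∧ Runs f D P σ' t (I (j + 1))) :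
    Runs f D (.while e P) σ (N * (e.cost + t + 1) + (e.cost + 1))
      fun σ' => e.eval σ' = false ∧ ∃ j, I j σ' := by
  -- Induction on the number `m` of rounds still allowed; at `m = 0` a true guard contradicts `j <
  -- N`.
  have key : ∀ m j σ', j + m = N → Frame P σ σ' → I j σ' →
      Runs f D (.while e P) σ' (m * (e.cost + t + 1) + (e.cost + 1))
        fun σ' => e.eval σ' = false ∧ ∃ j, I j σ' := by
    intro m
    induction m with
    | zero =>
      intro j σ' hj hF hI
      cases he : e.eval σ' with
      | true => exact absurd (h j σ' hF hI he).1 (by omega)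
      | false => exact ⟨_, σ', .whileFalse he, by simp, he, j, hI⟩
    | succ m ih =>
      intro j σ' hj hF hI
      cases he : e.eval σ' with
      | true =>
        obtain ⟨-, s, σ₁, h₁, h₂, h₃⟩ := h j σ' hF hI he
        obtain ⟨s', σ₂, h₄, h₅, h₆⟩ := ih (j + 1) σ₁ (by omega) (hF.trans h₁.frame) h₃
        exact ⟨_, σ₂, .whileTrue he h₁ h₄, by rw [Nat.succ_mul]; omega, h₆⟩
      | false => exact ⟨_, σ', .whileFalse he, by omega, he, j, hI⟩
  exact key N 0 σ (by omega) (Frame.refl _ _) h₀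

end Runs

/-- Run `P` for the values `0, …, n - 1` of natural register `x`. -/
def forLoop (x : ℕ) (P : Program) : Program :=
  .seq (.setNat x (.const 0))
    (.while (.natLt (.reg x) (.reg 0)) (.seq P (.setNat x (.add (.reg x) (.const 1)))))

/-- The counter is written after the body, so the invariant must be insensitive to it (`hI`). The
bound has the shape `k * (n + 1) ^ d` on both sides so that nested loops compose. -/
theorem Runs.forLoop {x : ℕ} {P : Program} {σ : Store} (I : ℕ → Store → Prop) (k d : ℕ)
    (hx : x ≠ 0) (hn : σ.natReg 0 = n) (hP : x ∉ P.natWrites) (hP' : 0 ∉ P.natWrites)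
    (hI : ∀ i σ v, I i σ → I i { σ with natReg := Function.update σ.natReg x v })
    (h₀ : I 0 σ)
    (h : ∀ i σ', i < n → Frame (forLoop x P) σ σ' → σ'.natReg x = i → I i σ' →
      Runs f D P σ' (k * (n + 1) ^ d) (I (i + 1))) :
    Runs f D (forLoop x P) σ ((k + 20) * (n + 1) ^ (d + 1)) (I n) := by
  obtain ⟨t, ht⟩ : ∃ t, t = k * (n + 1) ^ d := ⟨_, rfl⟩
  rw [← ht] at h
  have hb : Runs f D (MultiAgentContract.forLoop x P) σ
      (((NatExp.const 0).cost + 1) + (n * (3 + (t + 4) + 1) + (3 + 1))) (I n) := by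
    refine .seq (.setNat ?_)
    set σ₀ : Store := { σ with natReg := Function.update σ.natReg x ((NatExp.const 0).eval σ) }
      with hσ₀
    have hF₀ : Frame (MultiAgentContract.forLoop x P) σ σ₀ := by
      constructor <;> intro y hy <;> simp [hσ₀]
      simp only [MultiAgentContract.forLoop, Program.natWrites] at hy
      rw [Function.update_of_ne]
      rintro rfl
      simp at hy
    refine (Runs.while_of_invariant (e := .natLt (.reg x) (.reg 0))
      (fun i σ' => i ≤ n ∧ σ'.natReg x = i ∧ I i σ') n (t + 4)
      ⟨Nat.zero_le _, by simp [NatExp.eval], hI _ _ _ h₀⟩ ?_).imp le_rfl ?_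
    · rintro j σ' hF ⟨hj, hxj, hIj⟩ he
      have hn' : σ'.natReg 0 = n := by
        rw [hF.nat 0 (by simp [Program.natWrites, hP', hx.symm]), ← hn]
        simp [Function.update_of_ne hx.symm]
      have hjn : j < n := by simpa [BoolExp.eval, NatExp.eval, hxj, hn'] using he
      refine ⟨hjn, .seq ((h j σ' hjn (hF₀.trans (hF.mono ?_ ?_ ?_ ?_)) hxj hIj).imp le_rfl
        fun σ'' hF'' hI'' => (Runs.setNat ?_))⟩
      · simp [MultiAgentContract.forLoop, Program.natWrites]
      · simp [MultiAgentContract.forLoop, Program.realWrites]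
      · simp [MultiAgentContract.forLoop, Program.realArrWrites]
      · simp [MultiAgentContract.forLoop, Program.boolArrWrites]
      · exact ⟨hjn, by simp [NatExp.eval, hF''.nat x hP, hxj], hI _ _ _ hI''⟩
    · rintro σ' hF ⟨he, j, hj, hxj, hIj⟩
      have hn' : σ'.natReg 0 = n := by
        rw [hF.nat 0 (by simp [Program.natWrites, hP', hx.symm]), ← hn]
        simp [Function.update_of_ne hx.symm]
      have : n ≤ j := by simpa [BoolExp.eval, NatExp.eval, hxj, hn'] using he
      rwa [le_antisymm this hj]
  refine hb.le ?_
  simp only [NatExp.cost]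
  have h₁ : 1 ≤ (n + 1) ^ d := Nat.one_le_pow' _ _
  calc _ ≤ (t + 20 * (n + 1) ^ d) * (n + 1) := by nlinarith
    _ = _ := by rw [ht]; ring

end Exec

/-! ## The algorithm

Real register `2` holds the value of the best feasible set found so far, which is kept in Boolean
array `0`. The set under consideration is held in Boolean array `1`. -/

/-- Store the minimum total share of the current set in real register `6`; the value of the set is
expected in real register `4`. -/
def shareLoop : Program :=
  forLoop 1 <|
    .ite (.arr 1 (.reg 1))
      (.seq (.setBoolArr 1 (.reg 1) (.const false)) <|
        .seq (.valueQuery 5 1) <|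
        .seq (.setBoolArr 1 (.reg 1) (.const true)) <|
        .ite (.realLt (.reg 5) (.reg 4))
          (.setReal 6 (.add (.reg 6) (.div (.arr 0 (.reg 1)) (.sub (.reg 4) (.reg 5)))))
          (.setReal 6 (.add (.reg 6) (.add (.reg 1) (.ofNat (.const 1))))))
      .skip

/-- Copy the current set to the best set. -/
def copyLoop : Program := forLoop 1 (.setBoolArr 0 (.reg 1) (.arr 1 (.reg 1)))

/-- Keep the current set if it is feasible and better than the best set. -/
def tryCurrent : Program :=
  .seq (.valueQuery 4 1) <|
  .seq (.setReal 6 (.ofNat (.const 0))) <|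
  .seq shareLoop <|
  .ite (.and (.not (.realLt (.reg 1) (.reg 6))) (.realLt (.reg 2) (.reg 4)))
    (.seq (.setReal 2 (.reg 4)) copyLoop)
    .skip

/-- Drop agents whose marginal is less than the `q`-th part of their price while there are any. -/
def prune (q : ℕ) : Program :=
  .seq (.setNat 1 (.const 0)) <|
  .while (.natLt (.reg 1) (.reg 0)) <|
    .ite (.arr 1 (.reg 1))
      (.seq (.valueQuery 4 1) <|
        .seq (.setBoolArr 1 (.reg 1) (.const false)) <|
        .seq (.valueQuery 5 1) <|
        .ite (.realLt (.sub (.reg 4) (.reg 5)) (.div (.arr 1 (.reg 1)) (.ofNat (.const q))))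
          (.setNat 1 (.const 0))
          (.seq (.setBoolArr 1 (.reg 1) (.const true)) <|
            .setNat 1 (.add (.reg 1) (.const 1))))
      (.setNat 1 (.add (.reg 1) (.const 1)))

/-- The value `(a / 4) ^ 2 * x`. -/
def cap : RealExp :=
  .mul (.mul (.div (.reg 0) (.ofNat (.const 4))) (.div (.reg 0) (.ofNat (.const 4)))) (.reg 3)

/-- Drop agents one after the other until the value is at most `(a / 4) ^ 2 * x`. -/
def shrink : Program :=
  forLoop 1 <|
    .seq (.valueQuery 4 1) <|
    .ite (.realLt cap (.reg 4)) (.setBoolArr 1 (.reg 1) (.const false)) .skip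

/-- Store the prices for the target value `x` in real array `1`. -/
def priceLoop : Program :=
  forLoop 1 <|
    .ite (.arr 2 (.reg 1))
      (.setRealArr 1 (.reg 1) (.reg 8))
      (.setRealArr 1 (.reg 1)
        (.mul (.div (.reg 0) (.ofNat (.const 2)))
          (.sqrt (.div (.mul (.arr 0 (.reg 1)) (.reg 3)) (.reg 1)))))

/-- Try all single agents, mark the infeasible ones in Boolean array `2`, and store an upper bound
for `f` in real register `8`. -/
def singleLoop : Program :=
  forLoop 2 <|
    .seq (.setBoolArr 1 (.reg 2) (.const true)) <|
    .seq (.valueQuery 7 1) <|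
    .seq (.setReal 8 (.add (.reg 8) (.reg 7))) <|
    .seq (.setBoolArr 2 (.reg 2) (.realLt (.mul (.reg 1) (.reg 7)) (.arr 0 (.reg 2)))) <|
    .seq tryCurrent <|
    .setBoolArr 1 (.reg 2) (.const false)

/-- Try the set obtained for the target value `x`, which is held in real register `3`. -/
def tryTarget : Program :=
  .seq priceLoop <| .seq (.demandQuery 1 1) <| .seq (prune 1) <| .seq shrink <|
    .seq (prune 2) tryCurrent

/-- Real register `9` holds the largest value of a feasible agent. -/
def targetLoop : Program :=
  .while (.realLt (.reg 3) (.mul (.ofNat (.reg 0)) (.reg 9))) <|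
    .seq tryTarget (.setReal 3 (.add (.reg 3) (.div (.reg 3) (.ofNat (.reg 0)))))

/-- The blank Boolean array `0` is the empty set of value `0`, a feasible start. Real register `8`
starts at `1` so that adding all single values gives a price above every value of `f`. -/
def algorithm : Program :=
  .seq (.setReal 8 (.ofNat (.const 1))) <|
  .seq singleLoop <|
  .seq (.setReal 9 (.reg 2)) <|
  .seq (.setReal 3 (.reg 2)) targetLoop

/-! ## Memory contents -/

/-- The set of agents with Boolean values `s`. -/
def teamOf (n : ℕ) (s : ℕ → Bool) : Finset (Fin n) := Finset.univ.filter fun i => s i = true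

theorem team_eq_teamOf (n : ℕ) (σ : Store) (x : ℕ) : σ.team n x = teamOf n (σ.boolArr x) := rfl

@[simp]
theorem mem_teamOf {n : ℕ} {s : ℕ → Bool} {i : Fin n} : i ∈ teamOf n s ↔ s i = true := by
  simp [teamOf]

theorem teamOf_update_true {n : ℕ} (s : ℕ → Bool) {i : ℕ} (hi : i < n) :
    teamOf n (Function.update s i true) = insert ⟨i, hi⟩ (teamOf n s) := by
  ext j
  by_cases h : (j : ℕ) = i <;> simp [h, Fin.ext_iff]

theorem teamOf_update_false {n : ℕ} (s : ℕ → Bool) {i : ℕ} (hi : i < n) :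
    teamOf n (Function.update s i false) = (teamOf n s).erase ⟨i, hi⟩ := by
  ext j
  by_cases h : (j : ℕ) = i <;> simp [h, Fin.ext_iff]

theorem teamOf_encodeTeam {n : ℕ} (S : Finset (Fin n)) : teamOf n (encodeTeam S) = S := by
  ext j
  simp [encodeTeam]

theorem sum_filter_lt_succ {n : ℕ} (S : Finset (Fin n)) (g : Fin n → ℝ) {i : ℕ} (hi : i < n) :
    ∑ j ∈ S with j.val < i + 1, g j =
      ∑ j ∈ S with j.val < i, g j + if ⟨i, hi⟩ ∈ S then g ⟨i, hi⟩ else 0 := by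
  have h : (S.filter fun j => j.val < i + 1) =
      (S.filter fun j => j.val < i) ∪ S.filter fun j => j = ⟨i, hi⟩ := by
    ext j
    simp only [Finset.mem_filter, Finset.mem_union, Fin.ext_iff]
    constructor
    · rintro ⟨h₁, h₂⟩
      rcases Nat.lt_succ_iff_lt_or_eq.1 h₂ with h | h <;> simp [h₁, h]
    · rintro (⟨h₁, h₂⟩ | ⟨h₁, h₂⟩) <;> exact ⟨h₁, by omega⟩
  rw [h, Finset.sum_union, Finset.filter_eq']
  · split_ifs <;> simp
  · rw [Finset.disjoint_filter]
    rintro j - h₁ rfl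
    exact lt_irrefl _ h₁

theorem sum_filter_lt_self {n : ℕ} (S : Finset (Fin n)) (g : Fin n → ℝ) :
    ∑ j ∈ S with j.val < n, g j = ∑ j ∈ S, g j := by
  rw [Finset.filter_true_of_mem fun j _ => j.2]

/-- The input is held where the machine received it. -/
structure HasInput {n : ℕ} (c : Fin n → ℝ) (a b : ℝ) (σ : Store) : Prop where
  nat : σ.natReg 0 = n
  quality : σ.realReg 0 = a
  budget : σ.realReg 1 = b
  cost : ∀ i : Fin n, σ.realArr 0 i = c i

theorem HasInput.frame {n : ℕ} {c : Fin n → ℝ} {a b : ℝ} {P : Program} {σ σ' : Store}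
    (h : HasInput c a b σ) (hF : Frame P σ σ') (h₁ : 0 ∉ P.natWrites) (h₂ : 0 ∉ P.realWrites)
    (h₃ : 1 ∉ P.realWrites) (h₄ : 0 ∉ P.realArrWrites) : HasInput c a b σ' :=
  ⟨(hF.nat 0 h₁).trans h.nat, (hF.real 0 h₂).trans h.quality, (hF.real 1 h₃).trans h.budget,
    fun i => by rw [hF.realArr 0 h₄, h.cost]⟩

/-- Boolean array `0` holds a feasible set and real register `2` its value. -/
structure HasBest {n : ℕ} (f : Finset (Fin n) → ℝ) (c : Fin n → ℝ) (b : ℝ) (σ : Store) :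
    Prop where
  feasible : IsFeasible f c b (teamOf n (σ.boolArr 0))
  value : σ.realReg 2 = f (teamOf n (σ.boolArr 0))

/-! ### Correctness and running time of the subroutines -/

section Specification

attribute [local simp] BoolExp.eval RealExp.eval NatExp.eval BoolExp.cost RealExp.cost NatExp.cost
  team_eq_teamOf

variable {n : ℕ} {f : Finset (Fin n) → ℝ} {D : (Fin n → ℝ) → Finset (Fin n)} {c : Fin n → ℝ}
  {a b : ℝ} {σ : Store}

/-- Each member is removed for one query and put back, so the set is unchanged after every round.
The strict comparison keeps zero denominators, where machine division returns `0`, away from the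
quotient. -/
theorem runs_shareLoop (hσ : HasInput c a b σ) {S : Finset (Fin n)}
    (hS : teamOf n (σ.boolArr 1) = S) (h₄ : σ.realReg 4 = f S) (h₆ : σ.realReg 6 = 0) :
    Runs f D shareLoop σ (65 * (n + 1) ^ 2) fun σ' =>
      teamOf n (σ'.boolArr 1) = S ∧ σ'.realReg 6 = ∑ i ∈ S, realShare f c b S i := by
  refine (Runs.forLoop (fun i σ' => teamOf n (σ'.boolArr 1) = S ∧
    σ'.realReg 6 = ∑ j ∈ S with j.val < i, realShare f c b S j) 45 1 (by decide) hσ.nat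
    (by decide) (by decide) (fun i σ v h => h) ⟨hS, by simp [h₆]⟩ ?_).imp le_rfl ?_
  · rintro i σ' hi hF hxi ⟨hT, hr⟩
    have hσ' := hσ.frame hF (by decide) (by decide) (by decide) (by decide)
    have h₄' := (hF.real 4 (by decide)).trans h₄
    have hmem : σ'.boolArr 1 i = true ↔ ⟨i, hi⟩ ∈ S := by rw [← hT, mem_teamOf]
    have hci := hσ'.cost ⟨i, hi⟩
    simp only at hci
    rw [sum_filter_lt_succ S _ hi]
    refine (Runs.ite (fun he => .seq <| .setBoolArr <| .seq <| .valueQuery <| .seq <|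
      .setBoolArr <| .ite (fun h => .setReal ?_) (fun h => .setReal ?_))
      (fun he => .skip ?_)).le ?_
    · simp [hxi] at h he ⊢
      have hi' := hmem.1 he
      rw [teamOf_update_false _ hi, hT, h₄'] at h
      rw [teamOf_update_true _ hi, teamOf_update_false _ hi, hT, hr, h₄', hci, if_pos hi',
        realShare, marginal_of_mem hi', if_pos (sub_pos.2 h)]
      exact ⟨Finset.insert_eq_of_mem hi', rfl⟩
    · simp [hxi] at h he ⊢
      have hi' := hmem.1 he
      rw [teamOf_update_false _ hi, hT, h₄'] at h
      rw [teamOf_update_true _ hi, hT, hr, hσ'.budget, if_pos hi', realShare,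
        marginal_of_mem hi', if_neg (by linarith)]
      exact ⟨Finset.insert_eq_of_mem hi', rfl⟩
    · simp [hxi] at he
      rw [if_neg fun h => by simp [hmem.2 h] at he, add_zero]
      exact ⟨hT, hr⟩
    · simp
      omega
  · rintro σ' - ⟨h, h'⟩
    exact ⟨h, h'.trans (sum_filter_lt_self _ _)⟩

theorem runs_copyLoop (hσ : HasInput c a b σ) :
    Runs f D copyLoop σ (26 * (n + 1) ^ 1) fun σ' =>
      teamOf n (σ'.boolArr 0) = teamOf n (σ.boolArr 1) := by
  refine (Runs.forLoop (fun i σ' => ∀ j < i, σ'.boolArr 0 j = σ.boolArr 1 j) 6 0 (by decide)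
    hσ.nat (by decide) (by decide) (fun i σ v h => h) (by simp) ?_).imp le_rfl ?_
  · intro i σ' hi hF hxi h
    refine (Runs.setBoolArr fun j hj => ?_).le (by simp)
    rcases Nat.lt_succ_iff_lt_or_eq.1 hj with hj | rfl
    · simp [hxi, Function.update_of_ne hj.ne, h j hj]
    · simp [hxi, hF.boolArr 1 (by decide)]
  · intro σ' _ h
    ext i
    simp [h i i.2]

theorem runs_tryCurrent (hc : ∀ i, 0 < c i) (hb : 0 < b) (hσ : HasInput c a b σ)
    (hB : HasBest f c b σ) :
    Runs f D tryCurrent σ (120 * (n + 1) ^ 2) fun σ' =>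
      teamOf n (σ'.boolArr 1) = teamOf n (σ.boolArr 1) ∧ HasBest f c b σ' ∧
      σ.realReg 2 ≤ σ'.realReg 2 ∧
      (IsFeasible f c b (teamOf n (σ.boolArr 1)) →
        f (teamOf n (σ.boolArr 1)) ≤ σ'.realReg 2) := by
  have hσ₁ : ∀ v w, HasInput c a b { σ with
      realReg := Function.update (Function.update σ.realReg 4 v) 6 w } := fun v w =>
    ⟨hσ.nat, by simpa using hσ.quality, by simpa using hσ.budget, hσ.cost⟩
  refine (Runs.seq <| .valueQuery <| .seq <| .setReal <| .seq <|
    (runs_shareLoop (hσ₁ _ _) rfl ?_ ?_).imp le_rfl fun σ' hF hS =>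
    .ite (fun he => .seq <| .setReal <| (runs_copyLoop (c := c) (a := a) (b := b) ?_).imp le_rfl
      fun σ'' hF'' h => ?_) fun he => .skip ?_).le ?_
  · simp
  · simp
  · have h := (hσ₁ _ _).frame hF (by decide) (by decide) (by decide) (by decide)
    exact ⟨h.nat, by simpa using h.quality, by simpa using h.budget, h.cost⟩
  · have h₁ := (hF.real 1 (by decide)).trans (hσ₁ _ _).budget
    have h₂ := hF.real 2 (by decide)
    have h₄ := hF.real 4 (by decide)
    have h₂' := hF''.real 2 (by decide)
    have h₁' := hF''.boolArr 1 (by decide)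
    simp at h₂ h₄ he h₂' h₁' h
    simp only [h₁, h₂, h₄, hS.2, decide_eq_true_eq, decide_eq_false_iff_not,
      not_lt] at he
    rw [h₁', h₂', h₄]
    refine ⟨hS.1, ⟨?_, ?_⟩, he.2.le, fun _ => le_rfl⟩
    · rw [h, hS.1]
      exact (isFeasible_iff hc hb).2 he.1
    · rw [h, hS.1, h₂', h₄]
  · have h₁ := (hF.real 1 (by decide)).trans (hσ₁ _ _).budget
    have h₂ := hF.real 2 (by decide)
    have h₄ := hF.real 4 (by decide)
    have h₀ := hF.boolArr 0 (by decide)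
    simp at h₂ h₄ he h₀
    simp only [h₁, h₂, h₄, hS.2, decide_eq_false_iff_not, not_lt] at he
    refine ⟨hS.1, ⟨by rw [h₀]; exact hB.feasible, by rw [h₀, h₂]; exact hB.value⟩, h₂.ge, ?_⟩
    intro hT
    rw [h₂]
    exact he ((isFeasible_iff hc hb).1 hT)
  · have h : n + 1 ≤ (n + 1) ^ 2 := Nat.le_self_pow (by norm_num) _
    generalize (n + 1) ^ 2 = m at *
    simp
    omega

/-- Dropping an agent whose marginal is below `p i / q` raises `f - p / q`. XOS marginals may fall
when other agents leave, so the scan restarts after each drop. -/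
theorem runs_prune (q : ℕ) (hσ : HasInput c a b σ) {p : Fin n → ℝ}
    (h₁ : ∀ i : Fin n, σ.realArr 1 i = p i) {S : Finset (Fin n)}
    (hS : teamOf n (σ.boolArr 1) = S) :
    Runs f D (prune q) σ (60 * (n + 1) ^ 3) fun σ' =>
      teamOf n (σ'.boolArr 1) ⊆ S ∧
      f S - ∑ i ∈ S, p i / q ≤
        f (teamOf n (σ'.boolArr 1)) - ∑ i ∈ teamOf n (σ'.boolArr 1), p i / q ∧
      ∀ i ∈ teamOf n (σ'.boolArr 1), p i / q ≤ marginal f i (teamOf n (σ'.boolArr 1)) := by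
  -- The cost bound is a potential argument: a drop releases `n + 1`, paying for the round and for
  -- resetting the cursor to `0`; every other round moves the cursor and releases `1`.
  let I : ℕ → Store → Prop := fun j σ' => ∃ T, teamOf n (σ'.boolArr 1) = T ∧
    T ⊆ S ∧ f S - ∑ i ∈ S, p i / q ≤ f T - ∑ i ∈ T, p i / q ∧
    (∀ i ∈ T, i.val < σ'.natReg 1 → p i / q ≤ marginal f i T) ∧
    j + T.card * (n + 1) + (n - σ'.natReg 1) ≤ (n + 1) ^ 2 ∧ σ'.natReg 0 = n
  have h₀ : I 0 { σ with natReg := Function.update σ.natReg 1 0 } := by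
    refine ⟨S, hS, subset_rfl, le_rfl, by simp, ?_, by simpa using hσ.nat⟩
    have := card_finset_fin_le S
    simp
    nlinarith
  refine (Runs.seq <| .setNat <| (Runs.while_of_invariant I ((n + 1) ^ 2) (2 * n + 40) h₀ ?_).imp
    le_rfl ?_).le ?_
  · rintro j σ' hF ⟨T, hT, hTS, hfT, hm, hj, hn⟩ he
    simp [hn] at he
    obtain ⟨i, hi⟩ : ∃ i, σ'.natReg 1 = i := ⟨_, rfl⟩
    rw [hi] at he hj hm
    have hpi : σ'.realArr 1 i = p ⟨i, he⟩ := by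
      rw [← h₁ ⟨i, he⟩, hF.realArr 1 (by simp [Program.realArrWrites])]
    have hmem : σ'.boolArr 1 i = true ↔ ⟨i, he⟩ ∈ T := by rw [← hT, mem_teamOf]
    have next : ∀ k ∈ T, k.val < i + 1 → k.val < i ∨ k = ⟨i, he⟩ := fun k _ hk => by
      rw [Fin.ext_iff]
      exact Nat.lt_succ_iff_lt_or_eq.1 hk
    refine ⟨by omega, (Runs.ite (fun h => .seq <| .valueQuery <| .seq <| .setBoolArr <| .seq <|
      .valueQuery <| .ite (fun h' => .setNat ?_) (fun h' => .seq <| .setBoolArr <| .setNat ?_))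
      (fun h => .setNat ?_)).le ?_⟩
    · simp [hi] at h h'
      have hiT := hmem.1 h
      rw [teamOf_update_false _ he, hT, hpi] at h'
      refine ⟨T.erase ⟨i, he⟩, ?_, (Finset.erase_subset _ _).trans hTS, ?_, by simp, ?_, ?_⟩
      · simp [hi, teamOf_update_false _ he, hT]
      · rw [← Finset.add_sum_erase _ _ hiT] at hfT
        linarith
      · have h₁ := Finset.card_erase_add_one hiT
        simp
        rw [← h₁] at hj
        nlinarith [Nat.sub_le n i]
      · simpa using hn
    · simp [hi] at h h'
      have hiT := hmem.1 h
      rw [teamOf_update_false _ he, hT, hpi] at h'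
      refine ⟨T, ?_, hTS, hfT, ?_, ?_, ?_⟩
      · simp [hi, teamOf_update_true _ he, hT, Finset.insert_eq_of_mem hiT]
      · intro k hk hki
        simp [hi] at hki
        rcases next k hk (by omega) with hki | rfl
        · exact hm k hk hki
        · rw [marginal_of_mem hk]
          linarith
      · simp [hi]
        omega
      · simpa using hn
    · simp [hi] at h
      refine ⟨T, hT, hTS, hfT, ?_, ?_, by simpa using hn⟩
      · intro k hk hki
        simp [hi] at hki
        rcases next k hk (by omega) with hki | rfl
        · exact hm k hk hki
        · simp [hmem.2 hk] at h
      · simp [hi]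
        omega
    · simp
      omega
  · rintro σ' - ⟨he, j, T, rfl, hTS, hfT, hm, -, hn⟩
    simp [hn] at he
    exact ⟨hTS, hfT, fun i hi => hm i hi (i.2.trans_le he)⟩
  · simp
    nlinarith [Nat.zero_le (n ^ 3), Nat.zero_le (n ^ 2)]

/-- While the value exceeds the cap, every scanned agent is deleted, so one pass suffices: a final
set above the cap would be empty. A deletion happens only above `u` and loses at most the agent's
single value, so singles of at most `u / 3` never let the value fall below `2 * u / 3`. -/
theorem runs_shrink (h0 : f ∅ = 0)
    (hf : IsXOS f) {x : ℝ} (hx : 0 ≤ x)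
    (hσ : HasInput c a b σ) (h₃ : σ.realReg 3 = x)
    {S : Finset (Fin n)} (hS : teamOf n (σ.boolArr 1) = S) :
    Runs f D shrink σ (60 * (n + 1) ^ 2) fun σ' =>
      teamOf n (σ'.boolArr 1) ⊆ S ∧ f (teamOf n (σ'.boolArr 1)) ≤ (a / 4) ^ 2 * x ∧
      ((∀ i ∈ S, f {i} ≤ (a / 4) ^ 2 * x / 3) → 2 * ((a / 4) ^ 2 * x) / 3 ≤ f S →
        2 * ((a / 4) ^ 2 * x) / 3 ≤ f (teamOf n (σ'.boolArr 1))) := by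
  obtain ⟨u, hu⟩ : ∃ u, u = (a / 4) ^ 2 * x := ⟨_, rfl⟩
  have hu0 : 0 ≤ u := by rw [hu]; positivity
  rw [← hu]
  refine (Runs.forLoop (fun i σ' => ∃ T, teamOf n (σ'.boolArr 1) = T ∧ T ⊆ S ∧
    (u < f T → ∀ j ∈ T, i ≤ j.val) ∧ ((∀ i ∈ S, f {i} ≤ u / 3) → 2 * u / 3 ≤ f S →
      2 * u / 3 ≤ f T)) 40 1 (by decide) hσ.nat
    (by decide) (by decide) (fun i σ v h => h) ⟨S, hS, subset_rfl, by simp, fun _ h => h⟩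
    ?_).imp (by gcongr) ?_
  · rintro i σ' hi hF hxi ⟨T, hT, hTS, hT₁, hT₂⟩
    have hσ' := hσ.frame hF (by decide) (by decide) (by decide) (by decide)
    have h₃' := (hF.real 3 (by decide)).trans h₃
    have hcap : a / 4 * (a / 4) * x = u := by rw [hu]; ring
    refine (Runs.seq <| .valueQuery <| .ite (fun h => .setBoolArr ?_) (fun h => .skip ?_)).le ?_
    · simp [cap, hσ'.quality, h₃', hcap, hT] at h
      refine ⟨T.erase ⟨i, hi⟩, ?_, (Finset.erase_subset _ _).trans hTS, ?_, ?_⟩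
      · simp [hxi, teamOf_update_false _ hi, hT]
      · intro _ j hj
        rw [Finset.mem_erase, ne_eq, Fin.ext_iff] at hj
        have := hT₁ h j hj.2
        simp only at hj
        omega
      · intro hs _
        by_cases hiT : ⟨i, hi⟩ ∈ T
        · have h₁ := hf.marginal_le_single hiT
          rw [marginal_of_mem hiT] at h₁
          linarith [hs _ (hTS hiT)]
        · rw [Finset.erase_eq_of_notMem hiT]
          linarith
    · simp [cap, hσ'.quality, h₃', hcap, hT] at h
      exact ⟨T, hT, hTS, fun h' => absurd h' h.not_gt, hT₂⟩
    · simp [cap]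
      omega
  · rintro σ' - ⟨T, rfl, hTS, hT₁, hT₂⟩
    refine ⟨hTS, ?_, hT₂⟩
    by_contra! h
    have hT : teamOf n (σ'.boolArr 1) = ∅ :=
      Finset.eq_empty_of_forall_notMem fun j hj => (hT₁ h j hj).not_gt j.2
    rw [hT, h0] at h
    linarith

end Specification

/-! ### One target value, and the search over targets -/

section Algorithm

attribute [local simp] BoolExp.eval RealExp.eval NatExp.eval BoolExp.cost RealExp.cost NatExp.cost
  team_eq_teamOf

variable {n : ℕ} {I : Setting n} {D : (Fin n → ℝ) → Finset (Fin n)} {a b : ℝ} {σ : Store}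

/-- A price no set of agents is worth. -/
noncomputable def bigPrice (f : Finset (Fin n) → ℝ) : ℝ := 1 + ∑ i, f {i}

/-- The prices for target value `x`, which are prohibitive for infeasible agents. -/
noncomputable def targetPrice (I : Setting n) (a b x : ℝ) (i : Fin n) : ℝ :=
  if b * I.f {i} < I.c i then bigPrice I.f else price I.c a b x i

theorem Setting.nonneg (I : Setting n) (S : Finset (Fin n)) : 0 ≤ I.f S := by
  rw [← I.empty]
  exact I.mono _ _ (Finset.empty_subset S)

theorem lt_bigPrice (hf : IsXOS I.f) (S : Finset (Fin n)) : I.f S < bigPrice I.f := by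
  have h₁ := hf.le_sum_single S
  have h₂ := Finset.sum_le_sum_of_subset_of_nonneg (Finset.subset_univ S)
    fun i _ _ => I.nonneg {i}
  unfold bigPrice
  linarith

theorem targetPrice_nonneg (hf : IsXOS I.f) (ha : 0 < a) (x : ℝ) (i : Fin n) :
    0 ≤ targetPrice I a b x i := by
  unfold targetPrice
  split_ifs
  · exact (I.nonneg ∅).trans (lt_bigPrice hf _).le
  · unfold price
    positivity

/-- Infeasible agents are never demanded. -/
theorem cost_le_of_mem_demand (hf : IsXOS I.f) (ha : 0 < a) {x : ℝ} {S : Finset (Fin n)}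
    (hS : IsApproxDemandSet a I.f (targetPrice I a b x) S) {i : Fin n} (hi : i ∈ S) :
    I.c i ≤ b * I.f {i} := by
  by_contra! h
  -- Against the empty set, the demanded set has nonnegative utility, but a single prohibitive price
  -- already exceeds its value.
  have h₁ := hS ∅
  have h₂ := Finset.single_le_sum (fun j _ => targetPrice_nonneg (b := b) hf ha x j) hi
  rw [targetPrice, if_pos h] at h₂
  simp only [I.empty, mul_zero, Finset.sum_empty, sub_zero] at h₁
  linarith [lt_bigPrice hf S]

/-- The memory after the single agents have been processed. -/
structure IsPrepared (I : Setting n) (a b : ℝ) (σ : Store) : Prop where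
  input : HasInput I.c a b σ
  best : HasBest I.f I.c b σ
  marked : ∀ i : Fin n, σ.boolArr 2 i = true ↔ b * I.f {i} < I.c i
  big : σ.realReg 8 = bigPrice I.f
  single_le : ∀ i, I.c i ≤ b * I.f {i} → I.f {i} ≤ σ.realReg 2

theorem runs_priceLoop {x : ℝ} (hσ : IsPrepared I a b σ) (hx : σ.realReg 3 = x) :
    Runs I.f D priceLoop σ (60 * (n + 1) ^ 1) fun σ' =>
      ∀ i : Fin n, σ'.realArr 1 i = targetPrice I a b x i := by
  refine (Runs.forLoop (fun i σ' => ∀ j : Fin n, j.val < i →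
    σ'.realArr 1 j = targetPrice I a b x j) 40 0 (by decide)
    hσ.input.nat (by decide) (by decide) (fun i σ v h => h) (by simp) ?_).imp le_rfl
    fun σ' _ h j => h j j.2
  intro i σ' hi hF hxi h
  have hσ' := hσ.input.frame hF (by decide) (by decide) (by decide) (by decide)
  have hm := hσ.marked ⟨i, hi⟩
  rw [← hF.boolArr 2 (by decide)] at hm
  have h₃ := (hF.real 3 (by decide)).trans hx
  have h₈ := (hF.real 8 (by decide)).trans hσ.big
  have hci := hσ'.cost ⟨i, hi⟩
  simp only at hm hci
  refine (Runs.ite (fun he => .setRealArr fun j hj => ?_) fun he => .setRealArr fun j hj => ?_).le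
    (by simp)
  · rcases Nat.lt_succ_iff_lt_or_eq.1 hj with hj | hj
    · simp [hxi, Function.update_of_ne hj.ne, h j hj]
    · obtain rfl : j = ⟨i, hi⟩ := Fin.ext hj
      simp [hxi] at he ⊢
      rw [targetPrice, if_pos (hm.1 he), h₈]
  · rcases Nat.lt_succ_iff_lt_or_eq.1 hj with hj | hj
    · simp [hxi, Function.update_of_ne hj.ne, h j hj]
    · obtain rfl : j = ⟨i, hi⟩ := Fin.ext hj
      simp [hxi] at he ⊢
      rw [targetPrice, if_neg fun h => by simp [hm.2 h] at he, hci, h₃, hσ'.quality, hσ'.budget,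
        price]

theorem runs_singleLoop (hb : 0 < b) (hσ : HasInput I.c a b σ) (hB : HasBest I.f I.c b σ)
    (h₁ : teamOf n (σ.boolArr 1) = ∅) (h₈ : σ.realReg 8 = 1) :
    Runs I.f D singleLoop σ (220 * (n + 1) ^ 3) (IsPrepared I a b) := by
  refine (Runs.forLoop (fun i σ' => teamOf n (σ'.boolArr 1) = ∅ ∧ HasBest I.f I.c b σ' ∧
    (∀ j : Fin n, j.val < i → (σ'.boolArr 2 j = true ↔ b * I.f {j} < I.c j)) ∧
    σ'.realReg 8 = 1 + ∑ j with j.val < i, I.f {j} ∧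
    ∀ j : Fin n, j.val < i → I.c j ≤ b * I.f {j} → I.f {j} ≤ σ'.realReg 2) 200 2 (by decide)
    hσ.nat (by decide) (by decide) (fun i σ v h => ⟨h.1, ⟨h.2.1.1, h.2.1.2⟩, h.2.2⟩)
    ⟨h₁, hB, by simp, by simp [h₈], by simp⟩ ?_).imp le_rfl ?_
  · rintro i σ' hi hF hxi ⟨hT, hB', hm, hr, hs⟩
    have hσ' := hσ.frame hF (by decide) (by decide) (by decide) (by decide)
    have hci := hσ'.cost ⟨i, hi⟩
    simp only at hci
    have hsing : teamOf n (Function.update (σ'.boolArr 1) i true) = {⟨i, hi⟩} := by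
      rw [teamOf_update_true _ hi, hT, insert_empty_eq]
    refine (Runs.seq <| .setBoolArr <| .seq <| .valueQuery <| .seq <| .setReal <| .seq <|
      .setBoolArr <| .seq <| (runs_tryCurrent I.cost_pos hb (a := a) ?_ ?_).imp le_rfl
      fun σ'' hF'' h => .setBoolArr ?_).le ?_
    · exact ⟨hσ'.nat, by simpa using hσ'.quality, by simpa using hσ'.budget, hσ'.cost⟩
    · exact ⟨by simpa using hB'.feasible, by simpa using hB'.value⟩
    · have h₂ := hF''.boolArr 2 (by decide)
      have h₈ := hF''.real 8 (by decide)
      have hx₂ := hF''.nat 2 (by decide)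
      obtain ⟨hT', hB'', hle, hnew⟩ := h
      simp [hxi, hsing, hr, hσ'.budget, hci] at h₂ h₈ hx₂ hT' hle hnew
      have next : ∀ k : Fin n, k.val < i + 1 → k.val < i ∨ k = ⟨i, hi⟩ := fun k hk => by
        rw [Fin.ext_iff]
        exact Nat.lt_succ_iff_lt_or_eq.1 hk
      refine ⟨?_, ⟨by simpa using hB''.feasible, by simpa using hB''.value⟩, ?_, ?_, ?_⟩
      · simp [hx₂, teamOf_update_false _ hi, hT']
      · intro j hj
        simp [h₂]
        rcases next j hj with hj | rfl
        · simp [Function.update_of_ne hj.ne, hm j hj]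
        · simp
      · simp only [h₈]
        rw [sum_filter_lt_succ _ _ hi, if_pos (Finset.mem_univ _), add_assoc]
      · intro j hj hcj
        rcases next j hj with hj | rfl
        · exact (hs j hj hcj).trans hle
        · exact hnew (isFeasible_singleton I.empty I.cost_pos hb hcj)
    · have h : n + 1 ≤ (n + 1) ^ 2 := Nat.le_self_pow (by norm_num) _
      generalize (n + 1) ^ 2 = m at *
      simp
      omega
  · rintro σ' hF ⟨-, hB', hm, hr, hs⟩
    exact ⟨hσ.frame hF (by decide) (by decide) (by decide) (by decide), hB',
      fun i => hm i i.2, by rw [hr, sum_filter_lt_self]; rfl, fun i => hs i i.2⟩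

theorem IsPrepared.frame {P : Program} {σ' : Store} (h : IsPrepared I a b σ) (hF : Frame P σ σ')
    (h₁ : 0 ∉ P.natWrites) (h₂ : 0 ∉ P.realWrites) (h₃ : 1 ∉ P.realWrites)
    (h₄ : 0 ∉ P.realArrWrites) (h₅ : 2 ∉ P.realWrites) (h₆ : 8 ∉ P.realWrites)
    (h₇ : 0 ∉ P.boolArrWrites) (h₈ : 2 ∉ P.boolArrWrites) : IsPrepared I a b σ' where
  input := h.input.frame hF h₁ h₂ h₃ h₄
  best := ⟨by rw [hF.boolArr 0 h₇]; exact h.best.feasible,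
    by rw [hF.boolArr 0 h₇, hF.real 2 h₅]; exact h.best.value⟩
  marked := by rw [hF.boolArr 2 h₈]; exact h.marked
  big := (hF.real 8 h₆).trans h.big
  single_le := by rw [hF.real 2 h₅]; exact h.single_le

theorem targetPrice_of_le {x : ℝ} {i : Fin n} (h : I.c i ≤ b * I.f {i}) :
    targetPrice I a b x i = price I.c a b x i := if_neg h.not_gt

/-- A demand set, pruned, shrunk, and pruned again at half the prices, is feasible and has
a large value if there is a feasible set of value at least `x` and no agent has a large value. -/
theorem third_le_of_demand (hf : IsXOS I.f) (ha : 0 < a) (ha' : a ≤ 1) (hb : 0 < b) {x : ℝ}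
    (hx : 0 < x) {p : Fin n → ℝ} (hp : p = targetPrice I a b x) {S₀ S₁ S₂ S₃ T : Finset (Fin n)}
    (hS₀ : IsApproxDemandSet a I.f p S₀)
    (h₁ : S₁ ⊆ S₀) (hv₁ : I.f S₀ - ∑ i ∈ S₀, p i ≤ I.f S₁ - ∑ i ∈ S₁, p i)
    (hm₁ : ∀ i ∈ S₁, p i ≤ marginal I.f i S₁)
    (h₂ : S₂ ⊆ S₁) (hle : I.f S₂ ≤ (a / 4) ^ 2 * x)
    (hv₂ : (∀ i ∈ S₁, I.f {i} ≤ (a / 4) ^ 2 * x / 3) → 2 * ((a / 4) ^ 2 * x) / 3 ≤ I.f S₁ →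
      2 * ((a / 4) ^ 2 * x) / 3 ≤ I.f S₂)
    (h₃ : S₃ ⊆ S₂) (hv₃ : I.f S₂ - ∑ i ∈ S₂, p i / 2 ≤ I.f S₃ - ∑ i ∈ S₃, p i / 2)
    (hm₃ : ∀ i ∈ S₃, p i / 2 ≤ marginal I.f i S₃)
    (hs : ∀ i, I.c i ≤ b * I.f {i} → I.f {i} ≤ (a / 4) ^ 2 * x / 3)
    (hT : IsFeasible I.f I.c b T) (hxT : x ≤ I.f T) :
    IsFeasible I.f I.c b S₃ ∧ (a / 4) ^ 2 * x / 3 ≤ I.f S₃ := by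
  have hp0 : ∀ i, 0 ≤ p i := fun i => hp ▸ targetPrice_nonneg hf ha x i
  have hcost : ∀ i ∈ S₀, I.c i ≤ b * I.f {i} := fun i hi =>
    cost_le_of_mem_demand hf ha (hp ▸ hS₀) hi
  have hpT : ∑ i ∈ T, p i ≤ a / 2 * I.f T := by
    refine le_of_eq_of_le (Finset.sum_congr rfl fun i hi => ?_)
      (hT.sum_price_le hf I.cost_pos hb ha hx hxT)
    rw [hp, targetPrice_of_le (hT.cost_le hf I.cost_pos hb hi)]
  -- The utility of `S₁` is at least `a * f T - p(T) ≥ a * x / 2`, far above the `a^2 * x / 24`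
  -- needed since `a ≤ 1`.
  have hS₁ : 2 * ((a / 4) ^ 2 * x) / 3 ≤ I.f S₁ := by
    have h₄ := hS₀ T
    have h₅ := Finset.sum_nonneg fun i (_ : i ∈ S₁) => hp0 i
    have h₆ : a / 2 * x ≤ a / 2 * I.f T := mul_le_mul_of_nonneg_left hxT (by positivity)
    have h₇ : a * x * a ≤ a * x * 1 := mul_le_mul_of_nonneg_left ha' (by positivity)
    have h₈ : 0 < a * x := by positivity
    nlinarith
  have hS₂ := hv₂ (fun i hi => hs i (hcost i (h₁ hi))) hS₁
  -- The marginals are those in `S₁`, before shrinking; the marginals in `S₂` itself need not cover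
  -- the prices.
  have hpS₂ : ∑ i ∈ S₂, p i ≤ I.f S₂ :=
    (Finset.sum_le_sum fun i hi => hm₁ i (h₂ hi)).trans (hf.sum_marginal_le h₂)
  refine ⟨isFeasible_of_price_le hf I.cost_pos hb ha hx (fun i hi => ?_) ?_, ?_⟩
  · rw [← targetPrice_of_le (hcost i (h₁ (h₂ (h₃ hi)))), ← hp]
    exact hm₃ i hi
  · exact (I.mono _ _ h₃).trans hle
  -- `f S₃ ≥ f S₂ - p(S₂) / 2 ≥ f S₂ / 2`, and `f S₂` is at least two thirds of the cap.
  · have h₄ := Finset.sum_nonneg fun i (_ : i ∈ S₃) => hp0 i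
    rw [← Finset.sum_div, ← Finset.sum_div] at hv₃
    linarith

theorem runs_tryTarget (hf : IsXOS I.f) (ha : 0 < a) (ha' : a ≤ 1) (hb : 0 < b)
    (hD : IsApproxDemandOracle a I.f D) {x : ℝ} (hx : 0 < x) (hσ : IsPrepared I a b σ)
    (h₃ : σ.realReg 3 = x) :
    Runs I.f D tryTarget σ (500 * (n + 1) ^ 3) fun σ' =>
      IsPrepared I a b σ' ∧ σ.realReg 2 ≤ σ'.realReg 2 ∧
      ∀ T, IsFeasible I.f I.c b T → x ≤ I.f T → (a / 4) ^ 2 * x / 3 ≤ σ'.realReg 2 := by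
  obtain ⟨p, hp⟩ : ∃ p, p = targetPrice I a b x := ⟨_, rfl⟩
  have hp0 : ∀ i, 0 ≤ p i := fun i => hp ▸ targetPrice_nonneg hf ha x i
  have hS₀ := hD p hp0
  refine Runs.le (Runs.seq <| (runs_priceLoop hσ h₃).imp le_rfl fun σ₁ hF₁ h₁ => .seq ?_)
    (t := 60 * (n + 1) ^ 1 + ((n + 1) + (60 * (n + 1) ^ 3 + (60 * (n + 1) ^ 2 +
      (60 * (n + 1) ^ 3 + 120 * (n + 1) ^ 2))))) ?_
  swap
  · have h : n + 1 ≤ (n + 1) ^ 3 := Nat.le_self_pow (by norm_num) _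
    have h' : (n + 1) ^ 2 ≤ (n + 1) ^ 3 := Nat.pow_le_pow_right (by omega) (by norm_num)
    rw [pow_one]
    omega
  rw [← hp] at h₁
  have hσ₁ := hσ.frame hF₁ (by decide) (by decide) (by decide) (by decide) (by decide) (by decide)
    (by decide) (by decide)
  have hr₂ := hF₁.real 2 (by decide)
  have hr₃ := (hF₁.real 3 (by decide)).trans h₃
  refine Runs.demandQuery ?_
  rw [show (fun i : Fin n => σ₁.realArr 1 i) = p from funext h₁]
  obtain ⟨τ, hτ⟩ : ∃ τ : Store, τ = { σ₁ with
    boolArr := Function.update σ₁.boolArr 1 (encodeTeam (D p)) } := ⟨_, rfl⟩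
  have hτ' : IsPrepared I a b τ := by
    subst hτ
    exact ⟨⟨hσ₁.input.1, hσ₁.input.2, hσ₁.input.3, hσ₁.input.4⟩,
      ⟨by simpa using hσ₁.best.feasible, by simpa using hσ₁.best.value⟩,
      by simpa using hσ₁.marked, hσ₁.big, hσ₁.single_le⟩
  have hτ₁ : teamOf n (τ.boolArr 1) = D p := by simp [hτ, teamOf_encodeTeam]
  replace h₁ : ∀ i : Fin n, τ.realArr 1 i = p i := by simpa [hτ] using h₁
  replace hr₂ : τ.realReg 2 = σ.realReg 2 := by simpa [hτ] using hr₂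
  replace hr₃ : τ.realReg 3 = x := by simpa [hτ] using hr₃
  rw [← hτ]
  refine .seq <| (runs_prune 1 hτ'.input h₁ hτ₁).imp le_rfl fun σ₂ hF₂ hS₁ => ?_
  have hσ₂ := hτ'.frame hF₂ (by decide) (by decide) (by decide) (by decide) (by decide)
    (by decide) (by decide) (by decide)
  replace hr₂ := (hF₂.real 2 (by decide)).trans hr₂
  replace hr₃ := (hF₂.real 3 (by decide)).trans hr₃
  refine .seq <| (runs_shrink I.empty hf hx.le hσ₂.input hr₃ rfl).imp le_rfl
    fun σ₃ hF₃ hS₂ => ?_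
  have hσ₃ := hσ₂.frame hF₃ (by decide) (by decide) (by decide) (by decide) (by decide)
    (by decide) (by decide) (by decide)
  replace hr₂ := (hF₃.real 2 (by decide)).trans hr₂
  replace h₁ : ∀ i : Fin n, σ₃.realArr 1 i = p i := by
    rw [hF₃.realArr 1 (by decide), hF₂.realArr 1 (by decide)]
    exact h₁
  refine .seq <| (runs_prune 2 hσ₃.input h₁ rfl).imp le_rfl fun σ₄ hF₄ hS₃ => ?_
  have hσ₄ := hσ₃.frame hF₄ (by decide) (by decide) (by decide) (by decide) (by decide)
    (by decide) (by decide) (by decide)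
  replace hr₂ := (hF₄.real 2 (by decide)).trans hr₂
  refine (runs_tryCurrent I.cost_pos hb hσ₄.input hσ₄.best).imp le_rfl fun σ₅ hF₅ h₅ => ?_
  obtain ⟨-, hbest, hle, hnew⟩ := h₅
  refine ⟨⟨hσ₄.input.frame hF₅ (by decide) (by decide) (by decide) (by decide), hbest, ?_,
    (hF₅.real 8 (by decide)).trans hσ₄.big, fun i hi => (hσ₄.single_le i hi).trans hle⟩,
    hr₂.symm.trans_le hle, fun T hT hxT => ?_⟩
  · rw [hF₅.boolArr 2 (by decide)]
    exact hσ₄.marked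
  -- A feasible agent worth more than a third of the cap was already accounted for among the single
  -- agents.
  · by_cases hs : ∀ i, I.c i ≤ b * I.f {i} → I.f {i} ≤ (a / 4) ^ 2 * x / 3
    · simp only [Nat.cast_one, div_one, Nat.cast_ofNat] at hS₁ hS₃
      obtain ⟨h₆, h₇⟩ := third_le_of_demand hf ha ha' hb hx hp hS₀ hS₁.1 hS₁.2.1 hS₁.2.2 hS₂.1
        hS₂.2.1 hS₂.2.2 hS₃.1 hS₃.2.1 hS₃.2.2 hs hT hxT
      exact h₇.trans (hnew h₆)
    · push Not at hs
      obtain ⟨i, hi, hi'⟩ := hs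
      exact hi'.le.trans ((hσ₄.single_le i hi).trans hle)

/-- The approximation ratio. -/
noncomputable def ratio (a : ℝ) (n : ℕ) : ℝ := 3 / (a / 4) ^ 2 + 3 / (a / 4) ^ 2 / n

theorem one_le_ratio (ha : 0 < a) (ha' : a ≤ 1) (n : ℕ) : 1 ≤ ratio a n := by
  have h₁ : 1 ≤ 3 / (a / 4) ^ 2 := by
    rw [le_div_iff₀ (by positivity)]
    nlinarith
  have h₂ : 0 ≤ 3 / (a / 4) ^ 2 / (n : ℝ) := by positivity
  unfold ratio
  linarith

theorem runs_targetLoop (hf : IsXOS I.f) (ha : 0 < a) (ha' : a ≤ 1) (hb : 0 < b)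
    (hD : IsApproxDemandOracle a I.f D) (hσ : IsPrepared I a b σ)
    (h₃ : σ.realReg 3 = σ.realReg 2) (h₉ : σ.realReg 9 = σ.realReg 2) :
    Runs I.f D targetLoop σ (600 * (n + 1) ^ 5) fun σ' =>
      IsValueApprox I.f I.c b (ratio a n) (teamOf n (σ'.boolArr 0)) := by
  obtain ⟨M, hM⟩ : ∃ M, M = σ.realReg 2 := ⟨_, rfl⟩
  rw [← hM] at h₃ h₉
  have hM0 : 0 ≤ M := by
    rw [hM, hσ.best.value]
    exact I.nonneg _
  have hr := one_le_ratio ha ha' n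
  -- Feasible sets of value up to the current target are already approximated. The geometric growth
  -- is only recorded through the weaker arithmetic bound `M + j * (M / n)`, which is enough for a
  -- polynomial number of rounds.
  refine ((Runs.while_of_invariant (fun j σ' => IsPrepared I a b σ' ∧
    M + j * (M / n) ≤ σ'.realReg 3 ∧ ∀ T, IsFeasible I.f I.c b T → I.f T ≤ σ'.realReg 3 →
      I.f T ≤ ratio a n * σ'.realReg 2) ((n + 1) ^ 2) (500 * (n + 1) ^ 3 + 7)
    ⟨hσ, by simp [h₃], fun T _ hT => ?_⟩ ?_).imp le_rfl ?_).le ?_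
  · rw [h₃] at hT
    rw [← hM]
    nlinarith
  · rintro j σ' hF ⟨hσ', hx, hT⟩ he
    have h₉' := (hF.real 9 (by decide)).trans h₉
    obtain ⟨x, hx'⟩ : ∃ x, σ'.realReg 3 = x := ⟨_, rfl⟩
    have hn' := hσ'.input.nat
    simp [hn', h₉', hx'] at he
    rw [hx'] at hx hT
    -- If `M = 0` or `n = 0`, the guard reads `x < 0`, contrary to the invariant.
    have hMpos : 0 < M := by
      refine hM0.lt_of_ne fun h => ?_
      rw [← h] at he hx
      simp at he hx
      linarith
    have hnpos : (0 : ℝ) < n := by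
      refine (Nat.cast_nonneg n).lt_of_ne fun h => ?_
      rw [← h] at he hx
      simp at he hx
      linarith
    have hxpos : 0 < x := lt_of_lt_of_le (by positivity) hx
    refine ⟨?_, ?_⟩
    · have h₁ : (j : ℝ) * (M / n) < n * M := by linarith
      have h₂ : (j : ℝ) < n ^ 2 := by
        rw [mul_div_assoc', div_lt_iff₀ hnpos] at h₁
        nlinarith
      have h₃ : j < n ^ 2 := by exact_mod_cast h₂
      nlinarith
    · refine .seq <| (runs_tryTarget hf ha ha' hb hD hxpos hσ' hx').imp le_rfl
        fun σ'' hF'' h => .setReal ?_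
      obtain ⟨hσ'', hle, hnew⟩ := h
      have h₃'' := (hF''.real 3 (by decide)).trans hx'
      have hn'' := hσ''.input.nat
      refine ⟨⟨⟨hn'', by simpa using hσ''.input.quality, by simpa using hσ''.input.budget,
        hσ''.input.cost⟩, ⟨hσ''.best.feasible, by simpa using hσ''.best.value⟩, hσ''.marked,
        by simpa using hσ''.big, by simpa using hσ''.single_le⟩, ?_, fun T hT' hTx => ?_⟩
      · have h₁ : M ≤ x := le_trans (by simp; positivity) hx
        simp [h₃'', hn'']
        have : M / n ≤ x / n := by gcongr
        linarith
      · simp [h₃'', hn''] at hTx ⊢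
        -- Only values between `x` and `x + x / n` are new; for these the guarantee at target `x`
        -- loses the extra factor `1 + 1 / n`.
        rcases le_or_gt (I.f T) x with h | h
        · exact (hT T hT' h).trans (mul_le_mul_of_nonneg_left hle (by linarith))
        · refine hTx.trans (le_trans (le_of_eq ?_)
            (mul_le_mul_of_nonneg_left (hnew T hT' h.le) (by linarith)))
          unfold ratio
          field_simp
  · rintro σ' hF ⟨he, j, hσ', hx, hT⟩
    have h₉' := (hF.real 9 (by decide)).trans h₉
    have hn' := hσ'.input.nat
    simp [hn', h₉'] at he
    refine ⟨hσ'.best.feasible, fun T hT' => ?_⟩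
    rw [← hσ'.best.value]
    refine hT T hT' (le_trans ?_ he)
    -- On exit the target is at least `n * M`, which bounds every feasible value because members of
    -- feasible sets are feasible alone.
    calc I.f T ≤ ∑ i ∈ T, I.f {i} := hf.le_sum_single T
      _ ≤ ∑ i ∈ T, M := Finset.sum_le_sum fun i hi => by
        rw [hM]
        exact hσ.single_le i (hT'.cost_le hf I.cost_pos hb hi)
      _ ≤ n * M := by
        rw [Finset.sum_const, nsmul_eq_mul]
        gcongr
        exact_mod_cast card_finset_fin_le T
  · have h₁ : 1 ≤ (n + 1) ^ 2 := Nat.one_le_pow' _ _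
    have h₂ : 1 ≤ (n + 1) ^ 3 := Nat.one_le_pow' _ _
    rw [pow_add (n + 1) 2 3]
    generalize (n + 1) ^ 2 = k at *
    generalize (n + 1) ^ 3 = m at *
    simp
    nlinarith [Nat.mul_le_mul h₁ h₂, Nat.mul_le_mul_left k h₂]

theorem runs_algorithm (hf : IsXOS I.f) (ha : 0 < a) (ha' : a ≤ 1) (hb : 0 < b)
    (hD : IsApproxDemandOracle a I.f D) :
    Runs I.f D algorithm (initialStore I.c a b) (1000 * (n + 1) ^ 5) fun σ =>
      IsValueApprox I.f I.c b (ratio a n) (σ.team n 0) := by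
  refine (Runs.seq <| .setReal <| .seq <|
    (runs_singleLoop (a := a) hb ?_ ?_ ?_ ?_).imp le_rfl fun σ hF hσ => .seq <| .setReal <| .seq <|
    .setReal <| runs_targetLoop hf ha ha' hb hD ?_ ?_ ?_).le ?_
  · exact ⟨by simp [initialStore], by simp [initialStore], by simp [initialStore],
      fun i => by simp [initialStore]⟩
  · have h : teamOf n (fun _ => false) = ∅ := by ext; simp
    exact ⟨by simpa [initialStore, h] using isFeasible_empty I.cost_pos hb,
      by simp [initialStore, h, I.empty]⟩
  · ext; simp [initialStore]
  · simp
  · exact ⟨⟨hσ.input.nat, by simpa using hσ.input.quality, by simpa using hσ.input.budget,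
      hσ.input.cost⟩, ⟨hσ.best.feasible, by simpa using hσ.best.value⟩, hσ.marked,
      by simpa using hσ.big, by simpa using hσ.single_le⟩
  · simp
  · simp
  · have h₁ : 1 ≤ (n + 1) ^ 5 := Nat.one_le_pow' _ _
    have h₂ : (n + 1) ^ 3 ≤ (n + 1) ^ 5 := Nat.pow_le_pow_right (by omega) (by norm_num)
    generalize (n + 1) ^ 5 = m at *
    generalize (n + 1) ^ 3 = k at *
    simp
    omega

end Algorithm

theorem IsDemandOracle.isApproxDemandOracle {n : ℕ} {f : Finset (Fin n) → ℝ}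
    {D : (Fin n → ℝ) → Finset (Fin n)} (hD : IsDemandOracle f D) : IsApproxDemandOracle 1 f D :=
  fun p hp T => by simpa using hD p hp T

end MultiAgentContract

theorem mainTheorem7 :
    ∃ (prog : MultiAgentContract.Program) (time : Polynomial ℕ) (ε : ℝ → ℕ → ℝ),
      (∀ a : ℝ, 0 < a → a ≤ 1 → Tendsto (ε a) atTop (𝓝 0)) ∧
      -- the approximation guarantee with an `a`-demand oracle
      (∀ a : ℝ, 0 < a → a ≤ 1 →
        ∀ (n : ℕ) (I : MultiAgentContract.Setting n), MultiAgentContract.IsXOS I.f →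
        ∀ b : ℝ, 0 < b →
        ∀ D : (Fin n → ℝ) → Finset (Fin n), MultiAgentContract.IsApproxDemandOracle a I.f D →
          ∃ U : Finset (Fin n),
            MultiAgentContract.Outputs I.f D I.c a b prog (time.eval n) U ∧
            MultiAgentContract.IsValueApprox I.f I.c b (3 / (a / 4) ^ 2 + ε a n) U) ∧
      -- the guarantee with an exact demand oracle
      (∀ (n : ℕ) (I : MultiAgentContract.Setting n), MultiAgentContract.IsXOS I.f →
        ∀ b : ℝ, 0 < b →
        ∀ D : (Fin n → ℝ) → Finset (Fin n), MultiAgentContract.IsDemandOracle I.f D →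
          ∃ U : Finset (Fin n),
            MultiAgentContract.Outputs I.f D I.c 1 b prog (time.eval n) U ∧
            MultiAgentContract.IsValueApprox I.f I.c b (48 + ε 1 n) U) ∧
      -- scaling of the costs turns `b`-feasibility into `b'`-feasibility
      (∀ (n : ℕ) (I : MultiAgentContract.Setting n) (b b' : ℝ), 0 < b → 0 < b' →
        ∀ S : Finset (Fin n),
          MultiAgentContract.IsFeasible I.f I.c b S ↔
            MultiAgentContract.IsFeasible I.f (fun i => b' / b * I.c i) b' S) := by
  have main : ∀ a : ℝ, 0 < a → a ≤ 1 →
      ∀ (n : ℕ) (I : MultiAgentContract.Setting n), MultiAgentContract.IsXOS I.f →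
      ∀ b : ℝ, 0 < b →
      ∀ D : (Fin n → ℝ) → Finset (Fin n), MultiAgentContract.IsApproxDemandOracle a I.f D →
        ∃ U : Finset (Fin n),
          MultiAgentContract.Outputs I.f D I.c a b MultiAgentContract.algorithm
            ((1000 * (Polynomial.X + 1) ^ 5 : Polynomial ℕ).eval n) U ∧
          MultiAgentContract.IsValueApprox I.f I.c b
            (3 / (a / 4) ^ 2 + 3 / (a / 4) ^ 2 / n) U := by
    intro a ha ha' n I hf b hb D hD
    obtain ⟨s, σ, h₁, h₂, h₃⟩ := MultiAgentContract.runs_algorithm hf ha ha' hb hD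
    exact ⟨_, ⟨s, σ, h₁, by simpa using h₂, rfl⟩, h₃⟩
  -- The error term `3 / (a / 4) ^ 2 / n` is exactly the loss from the target grid. The fifth power
  -- comes from at most `(n + 1) ^ 2` targets at cubic cost each.
  refine ⟨MultiAgentContract.algorithm, 1000 * (Polynomial.X + 1) ^ 5,
    fun a n => 3 / (a / 4) ^ 2 / n, fun a _ _ => tendsto_const_div_atTop_nhds_zero_nat _, main,
    fun n I hf b hb D hD => ?_, fun n I b b' hb hb' S =>
      MultiAgentContract.isFeasible_scale I.cost_pos hb hb' S⟩
  have h := main 1 one_pos le_rfl n I hf b hb D hD.isApproxDemandOracle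
  have h48 : (3 : ℝ) / (1 / 4) ^ 2 = 48 := by norm_num
  simpa only [h48] using h
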